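/- All graphs are finite and simple. A generalized Halin graph $H = T\cup C$ is a plane graph that consists of a plane embedding of a tree $T$ with maximum degree $\Delta(T)\ge 3$ and a cycle $C$ whose vertices are exactly the leaves of $T$, such that $C$ is the boundary of the exterior face. Write $\theta(T)=\max_{xy\in E(T)}\{d_T(x)+d_T(y)\}$. A star edge coloring of a graph $G$ is a proper edge coloring in which no path and no cycle of length four (i.e. with four edges) is bichromatic. The list star chromatic index $\mathrm{ch}'_{\mathrm{star}}(G)$ is the least $k$ such that for every assignment $L$ of finite sets $L(e)$ with $|L(e)|\ge k$ to the edges $e$ of $G$ there is a star edge coloring $\varphi$ of $G$ with $\varphi(e)\in L(e)$ for every edge $e$. Theorem. If $H=T\cup C$ is a generalized Halin graph with $|C|\neq 5$, then $$\mathrm{ch}'_{\mathrm{star}}(H)\le \max\left\{\left\lfloor\frac{\theta(T)+\Delta(T)}{2}\right\rfloor,\ 2\left\lfloor\frac{\Delta(T)}{2}\right\rfloor+7\right\}.$$ -/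

import Mathlib

namespace SimpleGraph

variable {V : Type*}

section StarEdgeColoring

variable (G : SimpleGraph V)

/-- A walk is bichromatic under an edge coloring if exactly two colors occur on its edges. -/
def IsBichromatic {α : Type*} {G : SimpleGraph V} (φ : G.edgeSet → α) {u v : V}
    (p : G.Walk u v) : Prop :=
  (φ '' {e : G.edgeSet | (e : Sym2 V) ∈ p.edges}).ncard = 2

/-- A star edge coloring: a proper edge coloring (distinct edges with a common endpoint, i.e.
adjacent vertices of the line graph, get distinct colors) under which no path and no cycle
of length four is bichromatic. -/
structure IsStarEdgeColoring {α : Type*} {G : SimpleGraph V} (φ : G.edgeSet → α) : Prop where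
  proper : ∀ e f : G.edgeSet, G.lineGraph.Adj e f → φ e ≠ φ f
  path : ∀ (u v : V) (p : G.Walk u v), p.IsPath → p.length = 4 → ¬ IsBichromatic φ p
  cycle : ∀ (u : V) (p : G.Walk u u), p.IsCycle → p.length = 4 → ¬ IsBichromatic φ p

/-- `G` is star `k`-edge choosable: for every assignment `L` of finite lists of at least `k` colors
to the edges there is a star edge coloring that takes the color of each edge from its list. -/
def StarEdgeChoosable (k : ℕ) : Prop :=
  ∀ L : G.edgeSet → Finset ℕ, (∀ e, k ≤ (L e).card) →
    ∃ φ : G.edgeSet → ℕ, IsStarEdgeColoring φ ∧ ∀ e, φ e ∈ L e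

/-- The list star chromatic index: the least `k` such that `G` is star `k`-edge choosable
(`⊤` if there is no such `k`). -/
noncomputable def listStarChromaticIndex : ℕ∞ :=
  ⨅ k ∈ {k : ℕ | G.StarEdgeChoosable k}, (k : ℕ∞)

end StarEdgeColoring

/-- The maximum Ore-degree `θ(G)`, the maximum of `d(x) + d(y)` over the edges `xy` of `G`
(`0` if `G` has no edge). -/
def maxOreDegree (G : SimpleGraph V) [Fintype V] [DecidableRel G.Adj] : ℕ :=
  (Finset.univ : Finset G.Dart).sup fun d => G.degree d.fst + G.degree d.snd

/-- A rotation system of `G`: for every vertex `v` a cyclic order of the edges at `v`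
(their counterclockwise order around `v` in an embedding of `G` in an oriented surface).
An edge at `v` is represented by the dart that leaves `v` along it,
and `next` sends it to its successor in the cyclic order at `v`. -/
structure RotationSystem (G : SimpleGraph V) where
  next : Equiv.Perm G.Dart
  fst_next : ∀ d, (next d).fst = d.fst
  cyclic : ∀ d d' : G.Dart, d.fst = d'.fst → next.SameCycle d d'

namespace RotationSystem

variable {G : SimpleGraph V} (R : G.RotationSystem)

/-- The face-tracing permutation: after traversing a dart from `u` to `v`, continue along the edge
at `v` that follows the edge `vu` in the cyclic order at `v`. Its cycles are the boundary walks of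
the faces. -/
def facePerm : Equiv.Perm G.Dart :=
  (SimpleGraph.Dart.symm_involutive (G := G)).toPerm.trans R.next

/-- The faces of the embedding, each given by its boundary walk. -/
def Face : Type _ :=
  Quotient (Equiv.Perm.SameCycle.setoid R.facePerm)

/-- The rotation system describes an embedding of the connected graph `G` (with at least one edge)
in the sphere, equivalently in the plane: Euler's formula `|V| - |E| + |F| = 2` holds. -/
def IsPlane : Prop :=
  G.Connected ∧ Nat.card V + Nat.card R.Face = Nat.card G.edgeSet + 2

/-- The closed walk `C`, traversed as given, is the boundary walk of a face. -/
def IsFaceBoundary {u : V} (C : G.Walk u u) : Prop :=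
  ∃ d₀ : G.Dart, ∀ d : G.Dart, R.facePerm.SameCycle d₀ d ↔ d ∈ C.darts

end RotationSystem

/-- `H = T ∪ C` is a generalized Halin graph with characteristic tree `T` and adjoint cycle `C`:
`T` is a spanning tree of `H` with `Δ(T) ≥ 3`, `C` is a cycle whose vertices are exactly the
leaves of `T`, the edges of `H` are those of `T` and those of `C`, and `H` has a plane embedding
with `C` as boundary of the exterior face. (Any face of a spherical embedding may be
taken as the exterior one. The face may be traversed in either of the two directions of `C`.) -/
structure IsGeneralizedHalin [Fintype V] (H T : SimpleGraph V) [DecidableRel T.Adj]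
    {u : V} (C : H.Walk u u) : Prop where
  isTree : T.IsTree
  three_le_maxDegree : 3 ≤ T.maxDegree
  isCycle : C.IsCycle
  mem_support_iff : ∀ v : V, v ∈ C.support ↔ T.degree v = 1
  mem_edgeSet_iff : ∀ e : Sym2 V, e ∈ H.edgeSet ↔ e ∈ T.edgeSet ∨ e ∈ C.edges
  plane : ∃ R : H.RotationSystem, R.IsPlane ∧ (R.IsFaceBoundary C ∨ R.IsFaceBoundary C.reverse)

end SimpleGraph

/-! Bichromatic paths and cycles are excluded locally, at their middle vertex. For each vertex `u`
fix an antisymmetric relation `D u` on its tree neighbors, nearly a balanced tournament; `D u v w`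
permits an edge at `v` other than `uv` to repeat the color of `uw`. If `v₀v₁v₂v₃v₄` alternated
between two colors and `v₁v₂`, `v₂v₃` were tree edges, both `D v₂ v₁ v₃` and `D v₂ v₃ v₁` would
hold. By balance, each `v` has at most `1 + d(u)/2` critical edges `uw`, those whose color may not
recur at `v`.

The tree is colored from the root downwards, all child edges of one vertex `u` at a time
(`exists_isOriented`). With `p` the parent of `u`, at most `d(u)/2` child edges must avoid every
color at `p`; the others avoid only the critical ones. Greedy choice therefore needs about `d(p) +
d(u)/2` and `d(u) + d(p)/2` colors, which gives the term with `θ`. Consecutive leaves must also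
receive distinct tree colors. Planarity keeps this cheap: at most two cycle edges leave the subtree
below `u`. Indeed, Euler's formula leaves room for just one inner face per cycle edge, and the face
at a leaving edge must use the single tree edge above `u` in a prescribed direction
(`exists_leaving_pairs`).

A cycle edge then avoids the critical colors at its two ends, at most `1 + ⌊Δ/2⌋` each, and the tree
colors at the two neighboring leaves. Lists of size `2⌊Δ/2⌋ + 7` retain three colors, which suffice
for a cycle of length other than five (`exists_isStarSequence`). -/

open Finset

/-! ### Balanced orientations and greedy choices from lists -/

/-- An irreflexive antisymmetric relation in which every element of `S` is related to all but
at most `1 + |S| / 2` elements of `S`. -/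
theorem exists_balanced_orientation {V : Type*} (S : Finset V) :
    ∃ D : V → V → Prop, (∀ v w, D v w → ¬ D w v) ∧
      ∀ v ∈ S, ∀ N ⊆ S, (∀ w ∈ N, ¬ D v w) → #N ≤ 1 + #S / 2 := by
  classical
  let e := S.equivFin
  let r : V → ℕ := fun v => if h : v ∈ S then (e ⟨v, h⟩ : ℕ) else 0
  have hr : ∀ v ∈ S, r v < #S := fun v hv => by simp [r, hv]
  have hinj : ∀ v ∈ S, ∀ w ∈ S, r v = r w → v = w := by
    intro v hv w hw h
    simpa [r, hv, hw, Fin.val_inj] using h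
  refine ⟨fun v w => (r v < r w ∧ (r w - r v) % 2 = 1) ∨ (r w < r v ∧ (r v - r w) % 2 = 0),
    fun v w h => by omega, fun v hv N hN h => ?_⟩
  rw [← card_range (1 + #S / 2)]
  -- The unrelated elements have the parity of `r v` from `r v` upwards and the opposite parity
  -- below. Halving, after a shift by the parity of `r v`, is injective on these ranks.
  refine card_le_card_of_injOn (fun w => (r w + r v % 2) / 2) ?_ ?_
  · intro w hw
    have := h w hw
    have := hr w (hN hw)
    have := hr v hv
    simp only [coe_range, Set.mem_Iio]
    omega
  · intro w hw z hz hwz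
    have h1 := h w hw
    have h2 := h z hz
    refine hinj w (hN hw) z (hN hz) ?_
    dsimp only at hwz
    omega

/-- Greedy extension of an injective choice from lists. -/
theorem exists_extend_injOn {V α : Type*} [DecidableEq V] [DecidableEq α] (g : V → α)
    (Y X : Finset V) (hg : Set.InjOn g Y) (hd : Disjoint Y X) (N : V → Finset α)
    (hN : ∀ w ∈ X, #Y + #X ≤ #(N w)) :
    ∃ g' : V → α, Set.EqOn g' g Y ∧ Set.InjOn g' (Y ∪ X : Finset V) ∧ ∀ w ∈ X, g' w ∈ N w := by
  induction X using Finset.induction_on with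
  | empty => exact ⟨g, fun _ _ => rfl, by simpa using hg, by simp⟩
  | insert a X ha ih =>
    rw [disjoint_insert_right] at hd
    obtain ⟨g₁, h1, h2, h3⟩ := ih hd.2 fun w hw => by
      have := hN w (mem_insert_of_mem hw)
      rw [card_insert_of_notMem ha] at this
      omega
    obtain ⟨c, hc, hc'⟩ : ∃ c ∈ N a, c ∉ (Y ∪ X).image g₁ := by
      refine exists_mem_notMem_of_card_lt_card ?_
      have := hN a (mem_insert_self _ _)
      rw [card_insert_of_notMem ha] at this
      have := card_image_le (s := Y ∪ X) (f := g₁)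
      have := card_union_le Y X
      omega
    have hne : ∀ v ∈ Y ∪ X, v ≠ a := by
      rintro v hv rfl
      rcases mem_union.1 hv with h | h
      · exact hd.1 h
      · exact ha h
    have hupd : ∀ v ∈ Y ∪ X, Function.update g₁ a c v = g₁ v := fun v hv =>
      Function.update_of_ne (hne v hv) _ _
    refine ⟨Function.update g₁ a c, ?_, ?_, ?_⟩
    · intro v hv
      rw [hupd v (mem_union_left _ hv), h1 hv]
    · rw [union_insert, coe_insert, Set.injOn_insert]
      · refine ⟨fun v hv w hw h => h2 hv hw ?_, ?_⟩
        · rwa [hupd v hv, hupd w hw] at h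
        · rintro ⟨v, hv, hvc⟩
          rw [hupd v hv, Function.update_self] at hvc
          exact hc' (mem_image.2 ⟨v, hv, hvc⟩)
      · exact fun h => hne a h rfl
    · intro w hw
      rcases mem_insert.1 hw with rfl | hw
      · simpa using hc
      · rw [hupd w (mem_union_right _ hw)]
        exact h3 w hw

/-- Injective choice from the lists `L` on `X` that avoids a set `F` everywhere, a larger set `P` on
a subset `M`, and the additional colors `cons w`, which are present for at most two elements. -/
theorem exists_injOn_avoiding {V α : Type*} [DecidableEq V] [DecidableEq α] [Nonempty α]
    (X M : Finset V) (hMX : M ⊆ X)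
    (F P : Finset α) (hFP : F ⊆ P) (cons : V → Finset α) (L : V → Finset α) (K : ℕ)
    (hL : ∀ w, K ≤ #(L w)) (hcons : ∀ w, #(cons w) ≤ 2)
    (hB : #{w ∈ X | (cons w).Nonempty} ≤ 2) (h1 : #P + 4 ≤ K) (h2 : #P + #M ≤ K)
    (h3 : #F + #M + 4 ≤ K) (h4 : #F + #X ≤ K) :
    ∃ g : V → α, Set.InjOn g X ∧ ∀ w ∈ X, g w ∈ L w ∧ g w ∉ F ∧ g w ∉ cons w ∧
      (w ∈ M → g w ∉ P) := by
  set B := {w ∈ X | (cons w).Nonempty} with hBdef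
  have hBX : B ⊆ X := filter_subset _ _
  have hsd : ∀ (w : V) (Z : Finset α), K ≤ #(L w \ Z) + #Z := fun w Z => by
    have := le_card_sdiff Z (L w)
    have := hL w
    omega
  -- The most constrained elements come first: `B ∩ M`, then `M \ B`, `B \ M` and the rest, paid for
  -- by `h1`, `h2`, `h3` and `h4` respectively. The 4 in `h1` and `h3` is two elements of `B` plus
  -- two additional forbidden colors.
  obtain ⟨g₁, -, i1, m1⟩ := exists_extend_injOn (fun _ => Classical.arbitrary α) ∅ (B ∩ M)
    (by simp) (by simp) (fun w => L w \ (P ∪ cons w)) fun w _ => by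
      have := hsd w (P ∪ cons w)
      have := card_union_le P (cons w)
      have := hcons w
      have := card_le_card (inter_subset_left : B ∩ M ⊆ B)
      rw [card_empty]
      omega
  rw [empty_union] at i1
  obtain ⟨g₂, e2, i2, m2⟩ := exists_extend_injOn g₁ (B ∩ M) (M \ B) i1
    (disjoint_left.2 fun w h h' => (mem_sdiff.1 h').2 (mem_inter.1 h).1)
    (fun w => L w \ P) fun w _ => by
      have := hsd w P
      have := card_inter_add_card_sdiff M B
      rw [inter_comm]
      omega
  have hM : B ∩ M ∪ M \ B = M := by
    ext w
    simp only [mem_union, mem_inter, mem_sdiff]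
    tauto
  rw [hM] at i2
  obtain ⟨g₃, e3, i3, m3⟩ := exists_extend_injOn g₂ M (B \ M) i2 disjoint_sdiff
    (fun w => L w \ (F ∪ cons w)) fun w _ => by
      have := hsd w (F ∪ cons w)
      have := card_union_le F (cons w)
      have := hcons w
      have := card_le_card (sdiff_subset : B \ M ⊆ B)
      omega
  rw [union_sdiff_self_eq_union] at i3
  have hMB : M ∪ B ⊆ X := union_subset hMX hBX
  obtain ⟨g₄, e4, i4, m4⟩ := exists_extend_injOn g₃ (M ∪ B) (X \ (M ∪ B)) i3 disjoint_sdiff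
    (fun w => L w \ F) fun w _ => by
      have := hsd w F
      have := card_sdiff_add_card_eq_card hMB
      omega
  rw [union_sdiff_of_subset hMB] at i4
  refine ⟨g₄, i4, fun w hw => ?_⟩
  have hF : ∀ c, c ∉ P → c ∉ F := fun c hc h => hc (hFP h)
  have hnB : w ∉ B → cons w = ∅ := fun h => by
    by_contra hne
    exact h (mem_filter.2 ⟨hw, nonempty_iff_ne_empty.2 hne⟩)
  by_cases hwM : w ∈ M
  · have e : g₄ w = g₂ w := by
      rw [e4 (mem_union_left _ hwM), e3 hwM]
    by_cases hwB : w ∈ B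
    · rw [e, e2 (mem_inter.2 ⟨hwB, hwM⟩)]
      have := m1 w (mem_inter.2 ⟨hwB, hwM⟩)
      simp only [mem_sdiff, mem_union, not_or] at this
      exact ⟨this.1, hF _ this.2.1, this.2.2, fun _ => this.2.1⟩
    · rw [e, hnB hwB]
      have := m2 w (mem_sdiff.2 ⟨hwM, hwB⟩)
      simp only [mem_sdiff] at this
      exact ⟨this.1, hF _ this.2, by simp, fun _ => this.2⟩
  · by_cases hwB : w ∈ B
    · rw [e4 (mem_union_right _ hwB)]
      have := m3 w (mem_sdiff.2 ⟨hwB, hwM⟩)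
      simp only [mem_sdiff, mem_union, not_or] at this
      exact ⟨this.1, this.2.1, this.2.2, fun h => absurd h hwM⟩
    · rw [hnB hwB]
      have := m4 w (by simp [hw, hwM, hwB])
      simp only [mem_sdiff] at this
      exact ⟨this.1, this.2, by simp, fun h => absurd h hwM⟩

/-! ### Star edge colorings of a cycle from lists of three colors -/

section Cycle

/-- `g` is a star coloring of the edges of the cycle obtained from its period. -/
def IsStarSequence (g : ℕ → ℕ) : Prop :=
  (∀ i, g i ≠ g (i + 1)) ∧ ∀ i, g i = g (i + 2) → g (i + 1) ≠ g (i + 3)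

theorem isStarSequence_mod {n : ℕ} (hn : 3 ≤ n) (f : ℕ → ℕ) (h1 : ∀ i, i + 1 < n → f i ≠ f (i + 1))
    (h2 : f (n - 1) ≠ f 0) (h3 : ∀ i, i + 3 < n → f i = f (i + 2) → f (i + 1) ≠ f (i + 3))
    (h4 : f (n - 3) = f (n - 1) → f (n - 2) ≠ f 0) (h5 : f (n - 2) = f 0 → f (n - 1) ≠ f 1)
    (h6 : f (n - 1) = f 1 → f 0 ≠ f 2) : IsStarSequence fun i => f (i % n) := by
  have key : ∀ i k, k ≤ 3 → (i % n + k < n ∧ (i + k) % n = i % n + k) ∨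
      (n ≤ i % n + k ∧ (i + k) % n = i % n + k - n) := by
    intro i k hk
    have hlt := Nat.mod_lt i (show 0 < n by omega)
    rw [← Nat.mod_add_mod i n k]
    rcases lt_or_ge (i % n + k) n with h | h
    · exact Or.inl ⟨h, Nat.mod_eq_of_lt h⟩
    · refine Or.inr ⟨h, ?_⟩
      rw [Nat.mod_eq_sub_mod h, Nat.mod_eq_of_lt (by omega)]
  have hlt := fun i => Nat.mod_lt i (show 0 < n by omega)
  refine ⟨fun i => ?_, fun i => ?_⟩
  · dsimp only
    have := hlt i
    rcases key i 1 (by omega) with ⟨h, e⟩ | ⟨h, e⟩ <;> rw [e]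
    · exact h1 _ h
    · have : i % n = n - 1 := by omega
      rw [this, show n - 1 + 1 - n = 0 by omega]
      exact h2
  · dsimp only
    have hi := hlt i
    have k1 := key i 1 (by omega)
    have k2 := key i 2 (by omega)
    have k3 := key i 3 (by omega)
    rcases lt_or_ge (i % n + 3) n with h | h
    · rw [show (i + 1) % n = i % n + 1 by omega, show (i + 2) % n = i % n + 2 by omega,
        show (i + 3) % n = i % n + 3 by omega]
      exact h3 _ h
    · obtain h | h | h : i % n = n - 3 ∨ i % n = n - 2 ∨ i % n = n - 1 := by omega
      · rw [h, show (i + 1) % n = n - 2 by omega, show (i + 2) % n = n - 1 by omega,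
          show (i + 3) % n = 0 by omega]
        exact h4
      · rw [h, show (i + 1) % n = n - 1 by omega, show (i + 2) % n = 0 by omega,
          show (i + 3) % n = 1 by omega]
        exact h5
      · rw [h, show (i + 1) % n = 0 by omega, show (i + 2) % n = 1 by omega,
          show (i + 3) % n = 2 by omega]
        exact h6

/-- Repeat the block 012 and insert an extra 1 once or twice according to `n % 3`: the period is
012…012, 012…0121 or 012…0121 0121. The last pattern needs `n ≥ 8`, which is where length five drops
out. -/
theorem exists_isStarSequence_three {n : ℕ} (hn : 3 ≤ n) (hn5 : n ≠ 5) :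
    ∃ g : ℕ → ℕ, (∀ i, g (i + n) = g i) ∧ (∀ i, g i < 3) ∧ IsStarSequence g := by
  obtain ⟨f, hlt, h⟩ : ∃ f : ℕ → ℕ, (∀ i, f i < 3) ∧ ((n % 3 = 0 ∧ ∀ i, f i = i % 3) ∨
      (n % 3 = 1 ∧ f (n - 1) = 1 ∧ ∀ i, i + 1 < n → f i = i % 3) ∨
      (n % 3 = 2 ∧ f (n - 1) = 1 ∧ f (n - 5) = 1 ∧ (∀ i, i + 5 < n → f i = i % 3) ∧
        ∀ i, n < i + 5 → i + 1 < n → f i = (i + 2) % 3)) := by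
    obtain h | h | h : n % 3 = 0 ∨ n % 3 = 1 ∨ n % 3 = 2 := by omega
    · exact ⟨fun i => i % 3, fun i => Nat.mod_lt _ (by norm_num), Or.inl ⟨h, fun _ => rfl⟩⟩
    · exact ⟨fun i => if i + 1 < n then i % 3 else 1, fun i => by dsimp only; split_ifs <;> omega,
        Or.inr (Or.inl ⟨h, by simp only; rw [if_neg (by omega)],
          fun i hi => by simp only; rw [if_pos hi]⟩)⟩
    · refine ⟨fun i => if i + 5 < n then i % 3 else if n < i + 5 ∧ i + 1 < n then (i + 2) % 3 else 1,
        fun i => by dsimp only; split_ifs <;> omega, Or.inr (Or.inr ⟨h, ?_, ?_, fun i hi => ?_,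
          fun i hi hi' => ?_⟩)⟩
      · simp only; rw [if_neg (by omega), if_neg (by omega)]
      · simp only; rw [if_neg (by omega), if_neg (by omega)]
      · simp only; rw [if_pos hi]
      · simp only; rw [if_neg (by omega), if_pos ⟨hi, hi'⟩]
  refine ⟨fun i => f (i % n), fun i => by simp, fun i => hlt _, ?_⟩
  rcases h with ⟨h, hf⟩ | ⟨h, h1, hf⟩ | ⟨h, h1, h5, hf, hf'⟩
  · refine isStarSequence_mod hn f ?_ ?_ ?_ ?_ ?_ ?_ <;> intros <;> simp only [hf] at * <;> omega
  · have e0 := hf 0 (by omega)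
    have e1 := hf 1 (by omega)
    have e2 := hf 2 (by omega)
    have e3 := hf (n - 2) (by omega)
    have e4 := hf (n - 3) (by omega)
    refine isStarSequence_mod hn f (fun i hi => ?_) ?_ (fun i hi => ?_) ?_ ?_ ?_
    · obtain h' | h' : i + 2 < n ∨ i = n - 2 := by omega
      · rw [hf i (by omega), hf (i + 1) h']
        omega
      · rw [h', show n - 2 + 1 = n - 1 by omega]
        omega
    · omega
    · rw [hf i (by omega), hf (i + 2) (by omega)]
      omega
    all_goals omega
  · have e0 := hf 0 (by omega)
    have e1 := hf 1 (by omega)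
    have e2 := hf 2 (by omega)
    have e8 := hf (n - 8) (by omega)
    have e7 := hf (n - 7) (by omega)
    have e6 := hf (n - 6) (by omega)
    have e4 := hf' (n - 4) (by omega) (by omega)
    have e3 := hf' (n - 3) (by omega) (by omega)
    have e2' := hf' (n - 2) (by omega) (by omega)
    refine isStarSequence_mod hn f (fun i hi => ?_) ?_ (fun i hi => ?_) ?_ ?_ ?_
    · obtain h' | h' | h' | h' | h' | h' : i + 6 < n ∨ i = n - 6 ∨ i = n - 5 ∨ i = n - 4 ∨
        i = n - 3 ∨ i = n - 2 := by omega
      · rw [hf i (by omega), hf (i + 1) (by omega)]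
        omega
      · rw [h', show n - 6 + 1 = n - 5 by omega]; omega
      · rw [h', show n - 5 + 1 = n - 4 by omega]; omega
      · rw [h', show n - 4 + 1 = n - 3 by omega]; omega
      · rw [h', show n - 3 + 1 = n - 2 by omega]; omega
      · rw [h', show n - 2 + 1 = n - 1 by omega]; omega
    · omega
    · obtain h' | h' | h' | h' | h' : i + 7 < n ∨ i = n - 7 ∨ i = n - 6 ∨ i = n - 5 ∨ i = n - 4 := by
        omega
      · rw [hf i (by omega), hf (i + 2) (by omega)]
        omega
      · rw [h', show n - 7 + 1 = n - 6 by omega, show n - 7 + 2 = n - 5 by omega,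
          show n - 7 + 3 = n - 4 by omega]
        omega
      · rw [h', show n - 6 + 1 = n - 5 by omega, show n - 6 + 2 = n - 4 by omega,
          show n - 6 + 3 = n - 3 by omega]
        omega
      · rw [h', show n - 5 + 1 = n - 4 by omega, show n - 5 + 2 = n - 3 by omega,
          show n - 5 + 3 = n - 2 by omega]
        omega
      · rw [h', show n - 4 + 1 = n - 3 by omega, show n - 4 + 2 = n - 2 by omega,
          show n - 4 + 3 = n - 1 by omega]
        omega
    all_goals omega

/-- A choice from lists of three colors with prescribed first color such that three consecutive
values are distinct. -/
theorem exists_seq_of_three_le (A : ℕ → Finset ℕ) (hA : ∀ i, 3 ≤ #(A i)) {a : ℕ} (ha : a ∈ A 0) :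
    ∃ f : ℕ → ℕ, f 0 = a ∧ (∀ i, f i ∈ A i) ∧ (∀ i, f i ≠ f (i + 1)) ∧ ∀ i, f i ≠ f (i + 2) := by
  have pick : ∀ i x y, ∃ c ∈ A i, c ≠ x ∧ c ≠ y := by
    intro i x y
    obtain ⟨c, hc, h⟩ := exists_mem_notMem_of_card_lt_card
      (lt_of_le_of_lt (card_le_two (a := x) (b := y)) (hA i))
    exact ⟨c, hc, by simpa using h⟩
  choose p hp hpx hpy using pick
  let h : ℕ → ℕ × ℕ := fun i => Nat.rec (a, p 1 a a) (fun k q => (q.2, p (k + 2) q.1 q.2)) i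
  have hs : ∀ i, h (i + 1) = ((h i).2, p (i + 2) (h i).1 (h i).2) := fun _ => rfl
  refine ⟨fun i => (h i).1, rfl, fun i => ?_, fun i => ?_, fun i => ?_⟩
  · match i with
    | 0 => exact ha
    | 1 => exact hp _ _ _
    | i + 2 => dsimp only; rw [hs (i + 1), hs i]; exact hp _ _ _
  · match i with
    | 0 => exact (hpx _ _ _).symm
    | i + 1 => dsimp only; rw [hs (i + 1), hs i]; exact (hpy _ _ _).symm
  · dsimp only
    rw [hs (i + 1), hs i]
    exact (hpx _ _ _).symm

/-- A cycle of length `n ≠ 5` is star edge choosable from lists of three colors. -/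
theorem exists_isStarSequence {n : ℕ} (hn : 3 ≤ n) (hn5 : n ≠ 5) (A : ℕ → Finset ℕ)
    (hper : ∀ i, A (i + n) = A i) (hA : ∀ i, #(A i) = 3) :
    ∃ g : ℕ → ℕ, (∀ i, g (i + n) = g i) ∧ (∀ i, g i ∈ A i) ∧ IsStarSequence g := by
  have hmul : ∀ i m, A (i + m * n) = A i := by
    intro i m
    induction m with
    | zero => simp
    | succ m ih => rw [Nat.succ_mul, ← add_assoc, hper, ih]
  -- The index `s + (n - 1)` stands for the predecessor of `s`. If every list lies in the preceding
  -- one, all lists agree and the explicit three-color pattern applies. Otherwise some color `a` at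
  -- `s` is missing just before `s`; starting with `a` there makes the closing edge differ from it
  -- for free.
  by_cases hs : ∀ s, A s ⊆ A (s + (n - 1))
  · have hc : ∀ s, A s = A 0 := by
      intro s
      induction s with
      | zero => rfl
      | succ s ih =>
        rw [← ih]
        refine eq_of_subset_of_card_le ?_ (by simp [hA])
        have := hs (s + 1)
        rwa [show s + 1 + (n - 1) = s + n by omega, hper] at this
    obtain ⟨g, h1, h2, h3, h4⟩ := exists_isStarSequence_three hn hn5
    let e := (A 0).orderEmbOfFin (hA 0)
    refine ⟨fun i => e ⟨g i, h2 i⟩, fun i => ?_, fun i => ?_, fun i h => h3 i ?_,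
      fun i h h' => h4 i ?_ ?_⟩
    · simp [h1]
    · rw [hc]
      exact orderEmbOfFin_mem _ _ _
    · simpa using h
    · simpa using h
    · simpa using h'
  · push Not at hs
    obtain ⟨s, hs⟩ := hs
    obtain ⟨a, ha, ha'⟩ := not_subset.1 hs
    obtain ⟨f, hf0, hfm, hf1, hf2⟩ := exists_seq_of_three_le (fun i => A (i + s))
      (fun i => (hA _).ge) (by simpa using ha)
    have pick : ∀ i x y, ∃ c ∈ A i, c ≠ x ∧ c ≠ y := by
      intro i x y
      obtain ⟨c, hc, h⟩ := exists_mem_notMem_of_card_lt_card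
        (lt_of_le_of_lt (card_le_two (a := x) (b := y)) (hA i).ge)
      exact ⟨c, hc, by simpa using h⟩
    -- Only the last two values need care. The choices `p ≠ a` and `q ≠ f (n - 3)` rule out
    -- alternation in the windows that contain both positions; a window starting at the last
    -- position is broken by its second and fourth values.
    obtain ⟨p, hp, hp1, hp2⟩ := pick (n - 2 + s) (f (n - 3)) a
    obtain ⟨q, hq, hq1, hq2⟩ := pick (n - 1 + s) p (f (n - 3))
    have hqa : q ≠ a := by
      rintro rfl
      rw [add_comm] at hq
      exact ha' hq
    let f' : ℕ → ℕ := fun i => if i + 2 < n then f i else if i + 2 = n then p else q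
    have hlt : ∀ i, i + 2 < n → f' i = f i := fun i h => by simp [f', h]
    have e2 : f' (n - 2) = p := by
      simp only [f']
      rw [if_neg (by omega), if_pos (by omega)]
    have e1 : f' (n - 1) = q := by
      simp only [f']
      rw [if_neg (by omega), if_neg (by omega)]
    have e3 : f' (n - 3) = f (n - 3) := hlt _ (by omega)
    have e0 : f' 0 = a := by rw [hlt 0 (by omega), hf0]
    have hmem : ∀ i < n, f' i ∈ A (i + s) := by
      intro i hi
      obtain h | h | h : i + 2 < n ∨ i = n - 2 ∨ i = n - 1 := by omega
      · rw [hlt i h]; exact hfm i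
      · rw [h, e2]; exact hp
      · rw [h, e1]; exact hq
    have hadj : ∀ i, i + 1 < n → f' i ≠ f' (i + 1) := by
      intro i hi
      obtain h | h | h : i + 3 < n ∨ i = n - 3 ∨ i = n - 2 := by omega
      · rw [hlt i (by omega), hlt (i + 1) (by omega)]; exact hf1 i
      · rw [h, e3, show n - 3 + 1 = n - 2 by omega, e2]; exact hp1.symm
      · rw [h, e2, show n - 2 + 1 = n - 1 by omega, e1]; exact hq1.symm
    have hstar := isStarSequence_mod hn f' hadj (by rw [e1, e0]; exact hqa) (fun i hi h => by
        obtain h' | h' : i + 4 < n ∨ i = n - 4 := by omega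
        · rw [hlt i (by omega), hlt (i + 2) (by omega)] at h
          exact absurd h (hf2 i)
        · rw [h', show n - 4 + 1 = n - 3 by omega, show n - 4 + 3 = n - 1 by omega, e3, e1]
          exact hq2.symm)
      (fun h => by rw [e3, e1] at h; exact absurd h.symm hq2)
      (fun h => by rw [e2, e0] at h; exact absurd h hp2)
      (fun h => by
        rcases eq_or_ne n 3 with rfl | h3
        · exact absurd (by simpa using h.symm) (hadj 1 (by omega))
        rcases eq_or_ne n 4 with rfl | h4
        · rw [e0, show (2 : ℕ) = 4 - 2 from rfl, e2]; exact hp2.symm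
        · rw [hlt 0 (by omega), hlt 2 (by omega)]; exact hf2 0)
    -- Modulo `n`, adding `s * (n - 1)` subtracts `s`, which undoes the rotation.
    refine ⟨fun i => f' ((i + s * (n - 1)) % n), fun i => ?_, fun i => ?_, ?_, ?_⟩
    · simp [add_right_comm i n]
    · have h1 := hmem _ (Nat.mod_lt (i + s * (n - 1)) (show 0 < n by omega))
      have h2 := hmul ((i + s * (n - 1)) % n + s) ((i + s * (n - 1)) / n)
      have h3 := Nat.mod_add_div' (i + s * (n - 1)) n
      have h4 : s * (n - 1) + s = s * n := by
        rw [← Nat.mul_succ, Nat.succ_eq_add_one, Nat.sub_add_cancel (by omega)]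
      rw [show (i + s * (n - 1)) % n + s + (i + s * (n - 1)) / n * n = i + s * n by omega,
        hmul] at h2
      rwa [h2]
    · intro i
      have := hstar.1 (i + s * (n - 1))
      dsimp only at this ⊢
      rwa [add_right_comm i 1]
    · intro i
      have := hstar.2 (i + s * (n - 1))
      dsimp only at this ⊢
      rwa [add_right_comm i 1, add_right_comm i 2, add_right_comm i 3]

end Cycle

/-! ### Rooted trees -/

namespace SimpleGraph

variable {V : Type*}

/-- A description of a tree by a parent function. -/
structure Rooting (T : SimpleGraph V) (r : V) where
  par : V → V
  depth : V → ℕ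
  par_root : par r = r
  depth_par_lt : ∀ v, v ≠ r → depth (par v) < depth v
  adj_iff : ∀ a b, T.Adj a b ↔ (a ≠ r ∧ par a = b) ∨ (b ≠ r ∧ par b = a)

/-- The parent is the next vertex on a shortest path to the root. The edges from non-root vertices
to their parents are distinct, and a tree has no more edges than that, so they are all of its edges.
-/
theorem IsTree.nonempty_rooting [Fintype V] {T : SimpleGraph V} (hT : T.IsTree) (r : V) :
    Nonempty (Rooting T r) := by
  classical
  have hex : ∀ v, ∃ p, v ≠ r → T.Adj v p ∧ T.dist p r < T.dist v r := by
    intro v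
    by_cases hv : v = r
    · exact ⟨v, fun h => absurd hv h⟩
    obtain ⟨p, hp⟩ := hT.connected.exists_walk_length_eq_dist v r
    cases p with
    | nil => exact absurd rfl hv
    | cons h q =>
      refine ⟨_, fun _ => ⟨h, ?_⟩⟩
      rw [← hp, Walk.length_cons]
      exact Nat.lt_succ_of_le (dist_le q)
  choose p hp using hex
  have hinj : Set.InjOn (fun v => s(v, p v)) (univ.erase r : Finset V) := by
    intro v hv w hw h
    simp only [coe_erase, coe_univ, Set.mem_sdiff, Set.mem_univ, Set.mem_singleton_iff,
      true_and] at hv hw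
    rcases Sym2.eq_iff.1 h with h | h
    · exact h.1
    · have h1 := (hp v hv).2
      have h2 := (hp w hw).2
      rw [h.2] at h1
      rw [← h.1] at h2
      omega
  have himg : (univ.erase r).image (fun v => s(v, p v)) = T.edgeFinset := by
    refine eq_of_subset_of_card_le ?_ ?_
    · intro e he
      obtain ⟨v, hv, rfl⟩ := mem_image.1 he
      rw [mem_edgeFinset, mem_edgeSet]
      exact (hp v (ne_of_mem_erase hv)).1
    · rw [card_image_of_injOn hinj, card_erase_of_mem (mem_univ _), card_univ,
        ← hT.card_edgeFinset, Nat.add_sub_cancel]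
  refine ⟨⟨fun v => if v = r then r else p v, fun v => T.dist v r, if_pos rfl, fun v hv => ?_,
    fun a b => ⟨fun h => ?_, ?_⟩⟩⟩
  · rw [if_neg hv]
    exact (hp v hv).2
  · have : s(a, b) ∈ (univ.erase r).image (fun v => s(v, p v)) := by
      rw [himg, mem_edgeFinset]
      exact h
    obtain ⟨v, hv, he⟩ := mem_image.1 this
    have hv := ne_of_mem_erase hv
    rcases Sym2.eq_iff.1 he with ⟨rfl, rfl⟩ | ⟨rfl, rfl⟩
    · exact Or.inl ⟨hv, if_neg hv⟩
    · exact Or.inr ⟨hv, if_neg hv⟩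
  · rintro (⟨h, h'⟩ | ⟨h, h'⟩) <;> rw [if_neg h] at h' <;> subst h'
    · exact (hp _ h).1
    · exact (hp _ h).1.symm

namespace Rooting

variable {T : SimpleGraph V} {r : V} (P : Rooting T r)

/-- `v` lies in the subtree below `u`. -/
def Desc (u v : V) : Prop := ∃ k, P.par^[k] v = u

variable {P} in
theorem Desc.of_par {u v : V} (h : P.Desc u (P.par v)) : P.Desc u v := by
  obtain ⟨k, hk⟩ := h
  exact ⟨k + 1, hk⟩

variable {P} in
theorem Desc.eq_or_par {u v : V} (h : P.Desc u v) : v = u ∨ P.Desc u (P.par v) := by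
  obtain ⟨k, hk⟩ := h
  cases k with
  | zero => exact Or.inl hk
  | succ k => exact Or.inr ⟨k, hk⟩

variable {P} in
theorem Desc.eq_or_depth_lt {u v : V} (h : P.Desc u v) : v = u ∨ P.depth u < P.depth v := by
  obtain ⟨k, hk⟩ := h
  induction k generalizing v with
  | zero => exact Or.inl hk
  | succ k ih =>
    have h1 := ih (v := P.par v) hk
    by_cases hv : v = r
    · subst hv
      rwa [P.par_root] at h1
    · have := P.depth_par_lt v hv
      rcases h1 with h1 | h1
      · exact Or.inr (h1 ▸ this)
      · exact Or.inr (h1.trans this)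

theorem adj_par {v : V} (hv : v ≠ r) : T.Adj v (P.par v) := (P.adj_iff _ _).2 (Or.inl ⟨hv, rfl⟩)

theorem par_par_ne {v : V} (hv : v ≠ r) (hp : P.par v ≠ r) : P.par (P.par v) ≠ v := by
  intro h
  have h1 := P.depth_par_lt _ hv
  have h2 := P.depth_par_lt _ hp
  rw [h] at h2
  omega

/-- The only edge that leaves the subtree below `u` joins `u` to its parent. -/
theorem eq_of_adj_of_desc {u a b : V} (hab : T.Adj a b) (ha : P.Desc u a) (hb : ¬ P.Desc u b) :
    a = u ∧ b = P.par u := by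
  rcases (P.adj_iff a b).1 hab with ⟨_, rfl⟩ | ⟨_, rfl⟩
  · rcases ha.eq_or_par with rfl | h
    · exact ⟨rfl, rfl⟩
    · exact absurd h hb
  · exact absurd ha.of_par hb

open Classical in
/-- The color of the edge `ab`, given the colors of the edges from the vertices to their parents. -/
noncomputable def edgeColor {α : Type*} (f : V → α) (a b : V) : α :=
  if a ≠ r ∧ P.par a = b then f a else f b

theorem edgeColor_par_right {α : Type*} (f : V → α) {v : V} (hv : v ≠ r) :
    P.edgeColor f v (P.par v) = f v := if_pos ⟨hv, rfl⟩

theorem edgeColor_par_left {α : Type*} (f : V → α) {v : V} (hv : v ≠ r) :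
    P.edgeColor f (P.par v) v = f v :=
  if_neg fun h => P.par_par_ne hv h.1 h.2

theorem edgeColor_congr {α : Type*} {f g : V → α} {a b : V} (h : T.Adj a b)
    (hpar : ∀ v, v ≠ r → (P.par v = a ∨ v = a) → f v = g v) :
    P.edgeColor f a b = P.edgeColor g a b := by
  rcases (P.adj_iff a b).1 h with ⟨h', rfl⟩ | ⟨h', rfl⟩
  · rw [P.edgeColor_par_right _ h', P.edgeColor_par_right _ h', hpar a h' (Or.inr rfl)]
  · rw [P.edgeColor_par_left _ h', P.edgeColor_par_left _ h', hpar b h' (Or.inl rfl)]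

/-! ### List coloring of the tree edges -/

/-- The relation `D u v w` holds whenever an edge at `v` other than `uv` has the color of
`uw`. -/
structure IsOriented (D : V → V → V → Prop) (S : Finset V) (f : V → ℕ) : Prop where
  sibling : ∀ w z, w ≠ r → z ≠ r → P.par w ∈ S → P.par z = P.par w → f w = f z → w = z
  cross : ∀ w z, w ≠ r → P.par w ∈ S → P.par w ≠ r → T.Adj (P.par (P.par w)) z →
    f w = P.edgeColor f (P.par (P.par w)) z →
      D (P.par (P.par w)) (P.par w) z ∧ D (P.par w) (P.par (P.par w)) w

/-- The fields of `IsOriented` follow the parent function; this is their symmetric form for a walk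
`w u v z`. The case `w = v` expresses properness, by distinct sibling colors or irreflexivity. -/
theorem IsOriented.rel [Fintype V] {P : Rooting T r} {D : V → V → V → Prop} {f : V → ℕ}
    (h : P.IsOriented D univ f) (hD : ∀ u v, ¬ D u v v) {u v w z : V} (huv : T.Adj u v)
    (huw : T.Adj u w) (hvz : T.Adj v z) (hzu : z ≠ u)
    (hc : P.edgeColor f v z = P.edgeColor f u w) : D u v w := by
  rcases (P.adj_iff u v).1 huv with ⟨hu, rfl⟩ | ⟨hv, rfl⟩
  · rcases (P.adj_iff u w).1 huw with ⟨_, rfl⟩ | ⟨hw, rfl⟩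
    · rw [P.edgeColor_par_right f hu] at hc
      rcases (P.adj_iff _ z).1 hvz with ⟨hp, rfl⟩ | ⟨hz, hz'⟩
      · have := h.cross u (P.par u) hu (mem_univ _) hp (P.adj_par hp).symm
          (by rw [← hc, P.edgeColor_par_left f hp, P.edgeColor_par_right f hp])
        exact absurd this.1 (hD _ _)
      · rw [← hz', P.edgeColor_par_left f hz] at hc
        exact absurd (h.sibling z u hz hu (mem_univ _) hz'.symm hc) hzu
    · rw [P.edgeColor_par_left f hw] at hc
      exact (h.cross w z hw (mem_univ _) hu hvz hc.symm).2
  · rcases (P.adj_iff v z).1 hvz with ⟨_, rfl⟩ | ⟨hz, rfl⟩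
    · exact absurd rfl hzu
    · rw [P.edgeColor_par_left f hz] at hc
      exact (h.cross z w hz (mem_univ _) hv huw hc).1

/-- A tree edge coloring that obeys the relations `D u` and gives distinct colors to the pairs of
edges listed by `A`, of which at most two leave each subtree below a child of a given vertex. -/
theorem exists_isOriented [Fintype V] [DecidableRel T.Adj] (D : V → V → V → Prop)
    (hirr : ∀ u v, ¬ D u v v)
    (hD : ∀ u, ∀ v ∈ T.neighborFinset u, ∀ N ⊆ T.neighborFinset u, (∀ w ∈ N, ¬ D u v w) →
      #N ≤ 1 + T.degree u / 2)
    (K : ℕ) (L : V → Finset ℕ) (hL : ∀ v, K ≤ #(L v))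
    (hK1 : ∀ u v, T.Adj u v → T.degree u + T.degree v / 2 ≤ K)
    (hK2 : ∀ u v, T.degree u / 2 + T.degree v / 2 + 6 ≤ K)
    (A : V → V → Prop) (hAsymm : ∀ w w', A w w' → A w' w) (hAirr : ∀ w, ¬ A w w)
    (hAleaf : ∀ w w' z, A w w' → z ≠ r → P.par z ≠ w')
    (hA : ∀ u, ∃ E : Finset (V × V), #E ≤ 2 ∧
      ∀ w w', P.par w = u → A w w' → ¬ P.Desc u w' → (w, w') ∈ E) :
    ∃ f : V → ℕ, (∀ v, f v ∈ L v) ∧ P.IsOriented D univ f ∧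
      ∀ w w', w ≠ r → w' ≠ r → A w w' → f w ≠ f w' := by
  classical
  suffices H : ∀ S : Finset V, (∀ v ∈ S, v ≠ r → P.par v ∈ S) →
      ∃ f : V → ℕ, (∀ v, f v ∈ L v) ∧ P.IsOriented D S f ∧
        ∀ w w', w ≠ r → w' ≠ r → P.par w ∈ S → P.par w' ∈ S → A w w' → f w ≠ f w' by
    obtain ⟨f, h1, h2, h3⟩ := H univ (by simp)
    exact ⟨f, h1, h2, fun w w' hw hw' => h3 w w' hw hw' (mem_univ _) (mem_univ _)⟩
  intro S
  induction S using Finset.induction_on_max_value P.depth with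
  | empty =>
    intro _
    have : ∀ v, ∃ c, c ∈ L v := fun v => by
      have := hL v
      have := hK2 v v
      exact card_pos.1 (by omega)
    choose f hf using this
    exact ⟨f, hf, ⟨by simp, by simp⟩, by simp⟩
  | insert u S hu hmax ih =>
    intro hcl
    have hclS : ∀ v ∈ S, v ≠ r → P.par v ∈ S := fun v hv hvr => by
      rcases mem_insert.1 (hcl v (mem_insert_of_mem hv) hvr) with h | h
      · have h1 := P.depth_par_lt v hvr
        have h2 := hmax v hv
        rw [h] at h1
        omega
      · exact h
    obtain ⟨f, hfL, hfO, hfA⟩ := ih hclS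
    set p := P.par u with hp
    set X : Finset V := {w | w ≠ r ∧ P.par w = u} with hX
    have hmX : ∀ w, w ∈ X ↔ w ≠ r ∧ P.par w = u := fun w => by simp [hX]
    let cons : V → Finset ℕ := fun w =>
      ({w' | w ∈ X ∧ A w w' ∧ w' ≠ r ∧ P.par w' ∈ S} : Finset V).image f
    obtain ⟨E, hE2, hE⟩ := hA u
    -- Since `u` has maximal depth, no vertex of `S` lies below it, so a previously colored edge in
    -- conflict with a child edge of `u` comes from outside the subtree. The remaining case `w' = u`
    -- is excluded because `u` has a child.
    have hcross : ∀ w w', w ∈ X → A w w' → w' ≠ r → P.par w' ∈ S → (w, w') ∈ E := by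
      intro w w' hw hA' hw' hS
      obtain ⟨hwr, hwu⟩ := (hmX w).1 hw
      refine hE w w' hwu hA' fun hd => ?_
      rcases hd.eq_or_par with h | h
      · exact hAleaf w w' w hA' hwr (hwu.trans h.symm)
      · rcases h.eq_or_depth_lt with h | h
        · exact hu (h ▸ hS)
        · exact absurd (hmax _ hS) (not_le.2 h)
    have hcons : ∀ w, #(cons w) ≤ 2 := by
      intro w
      refine card_image_le.trans (le_trans ?_ hE2)
      refine card_le_card_of_injOn (fun w' => (w, w')) ?_ fun a _ b _ h => (Prod.ext_iff.1 h).2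
      intro w' hw'
      simp only [coe_filter, mem_univ, true_and, Set.mem_ofPred_eq] at hw'
      exact hcross w w' hw'.1 hw'.2.1 hw'.2.2.1 hw'.2.2.2
    have hB : #{w ∈ X | (cons w).Nonempty} ≤ 2 := by
      refine le_trans (card_le_card ?_) (card_image_le (s := E) (f := Prod.fst) |>.trans hE2)
      intro w hw
      obtain ⟨hwX, c, hc⟩ := mem_filter.1 hw
      obtain ⟨w', hw', -⟩ := mem_image.1 hc
      simp only [mem_filter, mem_univ, true_and] at hw'
      exact mem_image.2 ⟨(w, w'), hcross w w' hw'.1 hw'.2.1 hw'.2.2.1 hw'.2.2.2, rfl⟩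
    -- `Q` holds all colors at the parent `p`, `F` the critical ones as seen from `u`, and `M` the
    -- children whose edge may repeat no color at `p`. At the root all three are empty.
    obtain ⟨Q, F, M, hMX, hFQ, h1, h2, h3, h4, hQ, hF, hM⟩ : ∃ Q F : Finset ℕ, ∃ M : Finset V,
        M ⊆ X ∧ F ⊆ Q ∧ #Q + 4 ≤ K ∧ #Q + #M ≤ K ∧ #F + #M + 4 ≤ K ∧ #F + #X ≤ K ∧
        (u ≠ r → ∀ z, T.Adj p z → P.edgeColor f p z ∈ Q) ∧
        (u ≠ r → ∀ z, T.Adj p z → ¬ D p u z → P.edgeColor f p z ∈ F) ∧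
        (u ≠ r → ∀ w ∈ X, ¬ D u p w → w ∈ M) := by
      by_cases hur : u = r
      · refine ⟨∅, ∅, ∅, by simp, by simp, ?_, by simp, ?_, ?_, fun h => absurd hur h,
          fun h => absurd hur h, fun h => absurd hur h⟩
        · have := hK2 u u
          simp only [card_empty]
          omega
        · have := hK2 u u
          simp only [card_empty]
          omega
        · have hXd : #X ≤ T.degree u := by
            rw [← card_neighborFinset_eq_degree]
            refine card_le_card fun w hw => ?_
            obtain ⟨h1, h2⟩ := (hmX w).1 hw
            rw [mem_neighborFinset]
            exact h2 ▸ (P.adj_par h1).symm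
          have := hK2 u u
          simp only [card_empty]
          omega
      · have hup : T.Adj u p := P.adj_par hur
        have hpX : p ∉ X := fun h => P.par_par_ne hur ((hmX _).1 h).1 ((hmX _).1 h).2
        have hsub : insert p X ⊆ T.neighborFinset u := by
          intro w hw
          rw [mem_neighborFinset]
          rcases mem_insert.1 hw with rfl | hw
          · exact hup
          · obtain ⟨h1, h2⟩ := (hmX w).1 hw
            exact h2 ▸ (P.adj_par h1).symm
        have hXd : #X + 1 ≤ T.degree u := by
          rw [← card_neighborFinset_eq_degree, ← card_insert_of_notMem hpX]
          exact card_le_card hsub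
        set M := {w ∈ X | ¬ D u p w} with hM
        have hMd : #M ≤ T.degree u / 2 := by
          -- By irreflexivity `p` itself counts among the unrelated neighbors, so `M` loses the
          -- extra 1 of the balance bound.
          have := hD u p (by simpa using hup) (insert p M)
            ((insert_subset_insert p (filter_subset _ _)).trans hsub) (by
              intro w hw
              rcases mem_insert.1 hw with rfl | hw
              · exact hirr _ _
              · exact (mem_filter.1 hw).2)
          have hpM : p ∉ M := fun h => hpX (mem_filter.1 h).1
          rw [card_insert_of_notMem hpM] at this
          omega
        have hQd : #((T.neighborFinset p).image (P.edgeColor f p)) ≤ T.degree p := card_image_le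
        have hFd : #({z ∈ T.neighborFinset p | ¬ D p u z}.image (P.edgeColor f p)) ≤
            1 + T.degree p / 2 :=
          card_image_le.trans (hD p u (by simpa using hup.symm) _ (filter_subset _ _)
            fun w hw => (mem_filter.1 hw).2)
        have k1 := hK1 u p hup
        have k2 := hK1 p u hup.symm
        have k3 := hK2 u p
        have k4 := hK2 p p
        refine ⟨(T.neighborFinset p).image (P.edgeColor f p),
          {z ∈ T.neighborFinset p | ¬ D p u z}.image (P.edgeColor f p), M, filter_subset _ _,
          image_subset_image (filter_subset _ _), by omega, by omega, by omega, by omega,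
          fun _ z hz => mem_image_of_mem _ (by simpa using hz),
          fun _ z hz hd => mem_image_of_mem _ (by simp [hz, hd]),
          fun _ w hw hd => mem_filter.2 ⟨hw, hd⟩⟩
    obtain ⟨g, hg, hgX⟩ := exists_injOn_avoiding X M hMX F Q hFQ cons L K hL hcons hB h1 h2 h3 h4
    set f' : V → ℕ := fun v => if v ∈ X then g v else f v with hf'
    have hin : ∀ v, v ≠ r → P.par v = u → f' v = g v := fun v h h' => if_pos ((hmX v).2 ⟨h, h'⟩)
    have hout : ∀ v, P.par v ∈ S → f' v = f v := fun v h =>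
      if_neg fun h' => hu (((hmX v).1 h').2 ▸ h)
    have hcol : ∀ v z, v ≠ r → T.Adj (P.par v) z → P.par v ∈ S →
        P.edgeColor f' (P.par v) z = P.edgeColor f (P.par v) z := by
      intro v z hv hz hvS
      refine P.edgeColor_congr hz fun x hx h => hout x ?_
      rcases h with h | h
      · rwa [h]
      · rw [h] at hx ⊢
        exact hclS _ hvS hx
    have hAnew : ∀ w w', w ≠ r → w' ≠ r → P.par w = u → P.par w' ∈ insert u S → A w w' →
        f' w ≠ f' w' := by
      intro w w' hw hw' hwu hwS hA'
      rcases mem_insert.1 hwS with h | h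
      · rw [hin w hw hwu, hin w' hw' h]
        intro he
        have := hg ((hmX w).2 ⟨hw, hwu⟩) ((hmX w').2 ⟨hw', h⟩) he
        exact hAirr w (this ▸ hA')
      · rw [hin w hw hwu, hout w' h]
        have hwX := (hmX w).2 ⟨hw, hwu⟩
        intro he
        refine (hgX w hwX).2.2.1 ?_
        rw [he]
        exact mem_image_of_mem _ (by simp [hwX, hA', hw', h])
    refine ⟨f', fun v => ?_, ⟨fun w z hw hz hwS hzw he => ?_, fun w z hw hwS hwr hz he => ?_⟩,
      fun w w' hw hw' hwS hwS' hA' => ?_⟩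
    · by_cases h : v ∈ X
      · rw [hf']
        simp only [if_pos h]
        exact (hgX v h).1
      · rw [hf']
        simp only [if_neg h]
        exact hfL v
    · rcases mem_insert.1 hwS with h | h
      · rw [hin w hw h, hin z hz (hzw.trans h)] at he
        exact hg ((hmX w).2 ⟨hw, h⟩) ((hmX z).2 ⟨hz, hzw.trans h⟩) he
      · rw [hout w h, hout z (hzw ▸ h)] at he
        exact hfO.sibling w z hw hz h hzw he
    · rcases mem_insert.1 hwS with h | h
      · have hwX := (hmX w).2 ⟨hw, h⟩
        rw [h] at hwr hz he ⊢
        have hpS : p ∈ S := by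
          rcases mem_insert.1 (hcl u (mem_insert_self _ _) hwr) with h' | h'
          · exact absurd (h' ▸ P.depth_par_lt u hwr) (lt_irrefl _)
          · exact h'
        rw [hcol u z hwr hz hpS, hin w hw h] at he
        constructor
        · by_contra hd
          exact (hgX w hwX).2.1 (he ▸ hF hwr z hz hd)
        · by_contra hd
          exact (hgX w hwX).2.2.2 (hM hwr w hwX hd) (he ▸ hQ hwr z hz)
      · have hS := hclS _ h hwr
        rw [hout w h, hcol (P.par w) z hwr hz hS] at he
        exact hfO.cross w z hw h hwr hz he
    · rcases mem_insert.1 hwS with h | h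
      · exact hAnew w w' hw hw' h hwS' hA'
      · rcases mem_insert.1 hwS' with h' | h'
        · exact (hAnew w' w hw' hw h' hwS (hAsymm _ _ hA')).symm
        · rw [hout w h, hout w' h']
          exact hfA w w' hw hw' h h' hA'

end Rooting

/-! ### The cycle as a periodic sequence of leaves -/

/-- `H` is the union of a graph `T` and a cycle through the vertices of degree one of `T`, visited in
the order given by the `n`-periodic sequence `x`. -/
structure IsLeafCycle [Fintype V] (H T : SimpleGraph V) [DecidableRel T.Adj] (n : ℕ) (x : ℕ → V) :
    Prop where
  three_le : 3 ≤ n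
  eq_iff : ∀ i j, x i = x j ↔ i ≡ j [MOD n]
  adj_iff : ∀ a b, H.Adj a b ↔ T.Adj a b ∨ ∃ i, s(a, b) = s(x i, x (i + 1))
  degree_eq_one_iff : ∀ v, T.degree v = 1 ↔ ∃ i, x i = v

/-- Reduction of indices modulo the length removes the special role of the base point. The directed
darts are recorded because the two sides of a cycle edge belong to different faces. -/
theorem IsGeneralizedHalin.isLeafCycle [Fintype V] {H T : SimpleGraph V} [DecidableRel T.Adj]
    {u : V} {C : H.Walk u u} (hH : IsGeneralizedHalin H T C) :
    IsLeafCycle H T C.length (fun i => C.getVert (i % C.length)) ∧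
      ∀ d : H.Dart, d ∈ C.darts ↔ ∃ i, d.fst = C.getVert (i % C.length) ∧
        d.snd = C.getVert ((i + 1) % C.length) := by
  have h3 := hH.isCycle.three_le_length
  set n := C.length with hn
  have hlt : ∀ i, i % n < n := fun i => Nat.mod_lt i (by omega)
  have hsucc : ∀ i, C.getVert ((i + 1) % n) = C.getVert (i % n + 1) := by
    intro i
    rw [← Nat.mod_add_mod]
    rcases (Nat.succ_le_of_lt (hlt i)).lt_or_eq with h | h
    · rw [Nat.mod_eq_of_lt h]
    · rw [show i % n + 1 = n from h, Nat.mod_self, hn, C.getVert_length, C.getVert_zero]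
  have hdart : ∀ d : H.Dart, d ∈ C.darts ↔ ∃ i, d.fst = C.getVert (i % n) ∧
      d.snd = C.getVert ((i + 1) % n) := by
    intro d
    constructor
    · intro h
      obtain ⟨i, hi, rfl⟩ := List.getElem_of_mem h
      rw [Walk.length_darts, ← hn] at hi
      refine ⟨i, ?_⟩
      rw [hsucc, Nat.mod_eq_of_lt hi, C.darts_getElem_eq_getVert]
      exact ⟨rfl, rfl⟩
    · rintro ⟨i, h1, h2⟩
      rw [hsucc] at h2
      have hi : i % n < C.darts.length := by rw [Walk.length_darts]; exact hlt i
      have : d = C.darts[i % n] := by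
        rw [C.darts_getElem_eq_getVert]
        exact Dart.ext _ _ (Prod.ext h1 h2)
      rw [this]
      exact List.getElem_mem hi
  refine ⟨⟨h3, fun i j => ?_, fun a b => ?_, fun v => ?_⟩, hdart⟩
  · constructor
    · intro h
      have hi := hlt i
      have hj := hlt j
      exact hH.isCycle.getVert_injOn' (by simp only [Set.mem_ofPred_eq]; omega)
        (by simp only [Set.mem_ofPred_eq]; omega) h
    · intro h
      exact congrArg C.getVert h
  · rw [← mem_edgeSet, hH.mem_edgeSet_iff, mem_edgeSet]
    refine or_congr Iff.rfl ?_
    constructor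
    · intro h
      obtain ⟨d, hd, he⟩ := List.mem_map.1 h
      obtain ⟨i, h1, h2⟩ := (hdart d).1 hd
      refine ⟨i, ?_⟩
      rw [← he, ← h1, ← h2]
      rfl
    · rintro ⟨i, hi⟩
      rw [hi, hsucc]
      have hadj := C.adj_getVert_succ (hlt i)
      refine List.mem_map.2 ⟨⟨(C.getVert (i % n), C.getVert (i % n + 1)), hadj⟩, ?_, rfl⟩
      exact (hdart _).2 ⟨i, rfl, (hsucc i).symm⟩
  · rw [← hH.mem_support_iff, Walk.mem_support_iff_exists_getVert]
    constructor
    · rintro ⟨i, rfl, hi⟩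
      rcases hi.lt_or_eq with h | h
      · exact ⟨i, by rw [Nat.mod_eq_of_lt h]⟩
      · exact ⟨0, by rw [h, Nat.zero_mod, C.getVert_zero, C.getVert_length]⟩
    · rintro ⟨i, rfl⟩
      exact ⟨_, rfl, (hlt i).le⟩

theorem IsGeneralizedHalin.reverse [Fintype V] {H T : SimpleGraph V} [DecidableRel T.Adj]
    {u : V} {C : H.Walk u u} (hH : IsGeneralizedHalin H T C) :
    IsGeneralizedHalin H T C.reverse where
  isTree := hH.isTree
  three_le_maxDegree := hH.three_le_maxDegree
  isCycle := hH.isCycle.reverse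
  mem_support_iff v := by rw [Walk.support_reverse, List.mem_reverse, hH.mem_support_iff]
  mem_edgeSet_iff e := by rw [Walk.edges_reverse, List.mem_reverse, hH.mem_edgeSet_iff]
  plane := by
    obtain ⟨R, h, h'⟩ := hH.plane
    exact ⟨R, h, by rwa [Walk.reverse_reverse, or_comm]⟩

namespace IsLeafCycle

variable [Fintype V] {H T : SimpleGraph V} [DecidableRel T.Adj] {n : ℕ} {x : ℕ → V}

theorem adj_succ (h : IsLeafCycle H T n x) (i : ℕ) : H.Adj (x i) (x (i + 1)) :=
  (h.adj_iff _ _).2 (Or.inr ⟨i, rfl⟩)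

theorem eq_succ (h : IsLeafCycle H T n x) {i j : ℕ} (hij : x i = x j) : x (i + 1) = x (j + 1) :=
  (h.eq_iff _ _).2 (((h.eq_iff _ _).1 hij).add_right 1)

theorem eq_of_eq_succ (h : IsLeafCycle H T n x) {i j : ℕ} (hij : x (i + 1) = x (j + 1)) :
    x i = x j :=
  (h.eq_iff _ _).2 (((h.eq_iff _ _).1 hij).add_right_cancel' 1)

theorem apply_add (h : IsLeafCycle H T n x) (i : ℕ) : x (i + n) = x i :=
  (h.eq_iff _ _).2 (by simp [Nat.ModEq])

theorem apply_mod (h : IsLeafCycle H T n x) (i : ℕ) : x (i % n) = x i :=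
  (h.eq_iff _ _).2 (Nat.mod_modEq _ _)

theorem ne_add_two (h : IsLeafCycle H T n x) (i : ℕ) : x i ≠ x (i + 2) := by
  intro he
  have h1 := (h.eq_iff _ _).1 he
  have h2 : 0 ≡ 2 [MOD n] := Nat.ModEq.add_left_cancel' i (by simpa using h1)
  have h3 := h.three_le
  rw [Nat.ModEq, Nat.zero_mod, Nat.mod_eq_of_lt (by omega)] at h2
  omega

theorem eq_of_edge_eq (h : IsLeafCycle H T n x) {i j : ℕ}
    (he : s(x i, x (i + 1)) = s(x j, x (j + 1))) : x i = x j := by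
  rcases Sym2.eq_iff.1 he with h' | h'
  · exact h'.1
  · exact absurd (h'.2.symm.trans (h.eq_succ h'.1)) (h.ne_add_two j)

theorem ne_root (h : IsLeafCycle H T n x) {r : V} (hr : T.degree r ≠ 1) (i : ℕ) : x i ≠ r :=
  fun he => hr ((h.degree_eq_one_iff r).2 ⟨i, he⟩)

theorem eq_par (h : IsLeafCycle H T n x) {r : V} (hr : T.degree r ≠ 1) (P : Rooting T r) {i : ℕ}
    {v : V} (hv : T.Adj (x i) v) : v = P.par (x i) := by
  have h1 := (h.degree_eq_one_iff (x i)).2 ⟨i, rfl⟩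
  rw [← card_neighborFinset_eq_degree] at h1
  refine card_le_one.1 h1.le v (by simpa using hv) _ ?_
  simpa using P.adj_par (h.ne_root hr i)

theorem par_ne (h : IsLeafCycle H T n x) {r : V} (hr : T.degree r ≠ 1) (P : Rooting T r) {v : V}
    (hv : v ≠ r) (i : ℕ) : P.par v ≠ x i := by
  intro he
  have h1 := h.eq_par hr P (he ▸ P.adj_par hv).symm
  rw [← he] at h1
  exact P.par_par_ne hv (he ▸ h.ne_root hr i) h1.symm

theorem not_adj (h : IsLeafCycle H T n x) {r : V} (hr : T.degree r ≠ 1) (P : Rooting T r)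
    (i j : ℕ) : ¬ T.Adj (x i) (x j) := fun ha =>
  h.par_ne hr P (h.ne_root hr i) j (h.eq_par hr P ha).symm

/-- Leaves are pairwise nonadjacent in the tree, so tree and cycle edges are disjoint. In Euler's
formula this count forces exactly `n + 1` faces. -/
theorem card_edgeSet (h : IsLeafCycle H T n x) {r : V} (hr : T.degree r ≠ 1) (P : Rooting T r)
    (hT : T.IsTree) : Nat.card H.edgeSet + 1 = Fintype.card V + n := by
  classical
  have himg : H.edgeSet = (T.edgeFinset ∪ (range n).image fun i => s(x i, x (i + 1)) : Finset _) := by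
    ext e
    induction e using Sym2.ind with
    | _ a b =>
      simp only [mem_edgeSet, h.adj_iff, coe_union, coe_edgeFinset, coe_image, coe_range,
        Set.mem_union, Set.mem_image, Set.mem_Iio]
      refine or_congr Iff.rfl ⟨?_, ?_⟩
      · rintro ⟨i, hi⟩
        refine ⟨i % n, Nat.mod_lt _ (by have := h.three_le; omega), ?_⟩
        rw [hi, h.eq_succ (h.apply_mod i), h.apply_mod]
      · rintro ⟨i, -, hi⟩
        exact ⟨i, hi.symm⟩
  rw [himg, Nat.card_coe_set_eq, Set.ncard_coe_finset, card_union_of_disjoint,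
    card_image_of_injOn, card_range, add_right_comm, hT.card_edgeFinset]
  · intro i hi j hj he
    have := (h.eq_iff _ _).1 (h.eq_of_edge_eq he)
    simp only [coe_range, Set.mem_Iio] at hi hj
    rwa [Nat.ModEq, Nat.mod_eq_of_lt hi, Nat.mod_eq_of_lt hj] at this
  · rw [Finset.disjoint_left]
    intro e he he'
    obtain ⟨i, -, rfl⟩ := mem_image.1 he'
    exact h.not_adj hr P _ _ (by simpa using he)

end IsLeafCycle

/-! ### Faces, and cycle edges leaving a subtree -/

namespace RotationSystem

variable {G : SimpleGraph V} (R : G.RotationSystem)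

theorem fst_facePerm (d : G.Dart) : (R.facePerm d).fst = d.snd := R.fst_next d.symm

/-- A face does not turn back at the end of a dart unless that end has degree one. -/
theorem facePerm_ne_symm {d e : G.Dart} (h : e.fst = d.snd) (hne : e ≠ d.symm) :
    R.facePerm d ≠ d.symm := by
  intro hf
  have hc : R.next.SameCycle d.symm e := R.cyclic _ _ h.symm
  exact hne (hc.eq_of_left hf).symm

/-- A face that has a dart into `S` also has a dart out of `S`. -/
theorem exists_leaving_dart [Finite V] {d : G.Dart} (S : V → Prop) (h1 : S d.snd)
    (h2 : ¬ S d.fst) : ∃ e, R.facePerm.SameCycle d e ∧ S e.fst ∧ ¬ S e.snd := by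
  have : Finite G.Dart := Finite.of_injective Dart.toProd Dart.toProd_injective
  by_contra! hcon
  have key : ∀ k : ℕ, S ((R.facePerm ^ (k + 1)) d).fst := by
    intro k
    induction k with
    | zero => rwa [zero_add, pow_one, fst_facePerm]
    | succ k ih =>
      rw [pow_succ', Equiv.Perm.mul_apply, fst_facePerm]
      exact hcon _ ⟨(k + 1 : ℕ), by rw [zpow_natCast]⟩ ih
  -- The face returns to `d`; had it never left `S`, the tail of `d` would lie in `S`.
  have hpos := orderOf_pos R.facePerm
  have := key (orderOf R.facePerm - 1)
  rw [Nat.sub_add_cancel hpos, pow_orderOf_eq_one] at this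
  exact h2 this

end RotationSystem

namespace IsLeafCycle

variable [Fintype V] {H T : SimpleGraph V} [DecidableRel T.Adj] {n : ℕ} {x : ℕ → V}

/-- The dart of the cycle from `x (i + 1)` to `x i`. -/
def backDart (h : IsLeafCycle H T n x) (i : ℕ) : H.Dart := ⟨(x (i + 1), x i), (h.adj_succ i).symm⟩

theorem backDart_congr (h : IsLeafCycle H T n x) {i j : ℕ} (hij : x i = x j) :
    h.backDart i = h.backDart j :=
  Dart.ext _ _ (Prod.ext (h.eq_succ hij) hij)

theorem dart_cases (h : IsLeafCycle H T n x) (d : H.Dart) :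
    T.Adj d.fst d.snd ∨ (∃ i, d.fst = x i ∧ d.snd = x (i + 1)) ∨ ∃ i, d = h.backDart i := by
  rcases (h.adj_iff _ _).1 d.adj with h' | ⟨i, hi⟩
  · exact Or.inl h'
  · rcases Sym2.eq_iff.1 hi with h' | h'
    · exact Or.inr (Or.inl ⟨i, h'⟩)
    · exact Or.inr (Or.inr ⟨i, Dart.ext _ _ (Prod.ext h'.1 h'.2)⟩)

/-- No face consists of tree darts only. -/
theorem exists_not_adj (h : IsLeafCycle H T n x) {r : V} (hr : T.degree r ≠ 1) (P : Rooting T r)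
    (R : H.RotationSystem) (d : H.Dart) :
    ∃ e, R.facePerm.SameCycle d e ∧ ¬ T.Adj e.fst e.snd := by
  classical
  have : Finite H.Dart := Finite.of_injective Dart.toProd Dart.toProd_injective
  by_contra! hcon
  -- Take a dart with deepest head. If it points up, its predecessor has a deeper head. If it points
  -- down, the face cannot turn back, since the head has another edge in `H`, so the next tree dart
  -- goes deeper.
  obtain ⟨e, he, hmax⟩ := Set.exists_max_image {e | R.facePerm.SameCycle d e}
    (fun e => P.depth e.snd) (Set.toFinite _) ⟨d, Equiv.Perm.SameCycle.refl _ _⟩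
  rcases (P.adj_iff _ _).1 (hcon e he) with ⟨ha, hp⟩ | ⟨hb, hp⟩
  · have h1 := hmax (R.facePerm.symm e)
      (Equiv.Perm.sameCycle_apply_right.1 (by rwa [Equiv.apply_symm_apply]))
    have h2 : (R.facePerm.symm e).snd = e.fst := by
      rw [← R.fst_facePerm, Equiv.apply_symm_apply]
    have h3 := P.depth_par_lt _ ha
    simp only [h2] at h1
    rw [hp] at h3
    omega
  · have he' : R.facePerm.SameCycle d (R.facePerm e) := Equiv.Perm.sameCycle_apply_right.2 he
    have hne : R.facePerm e ≠ e.symm := by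
      obtain ⟨c, hc, hce⟩ : ∃ c, H.Adj e.snd c ∧ c ≠ e.fst := by
        by_cases hd : T.degree e.snd = 1
        · obtain ⟨i, hi⟩ := (h.degree_eq_one_iff _).1 hd
          refine ⟨x (i + 1), hi ▸ h.adj_succ i, fun h' => ?_⟩
          have := hcon e he
          rw [← hi, ← h'] at this
          exact h.not_adj hr P _ _ this
        · by_contra! hall
          refine hd ?_
          rw [← card_neighborFinset_eq_degree, card_eq_one]
          refine ⟨e.fst, ?_⟩
          ext c
          rw [mem_neighborFinset, mem_singleton]
          constructor
          · exact fun hc => hall c ((h.adj_iff _ _).2 (Or.inl hc))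
          · rintro rfl
            exact (hcon e he).symm
      refine R.facePerm_ne_symm (e := ⟨(e.snd, c), hc⟩) rfl fun h' => hce ?_
      exact congrArg (fun d : H.Dart => d.snd) h'
    have hfst := R.fst_facePerm e
    have hle := hmax _ he'
    rcases (P.adj_iff _ _).1 (hcon _ he') with ⟨_, hp'⟩ | ⟨hb', hp'⟩
    · refine hne (Dart.ext _ _ (Prod.ext hfst ?_))
      change (R.facePerm e).snd = e.fst
      rw [← hp', hfst, hp]
    · have h3 := P.depth_par_lt _ hb'
      rw [hp', hfst] at h3
      exact absurd hle (not_le.2 h3)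

/-- In a plane embedding with the cycle as boundary of a face, the other edge sides of the cycle
lie in pairwise distinct other faces. -/
theorem backDart_face (h : IsLeafCycle H T n x) {r : V} (hr : T.degree r ≠ 1) (P : Rooting T r)
    (hT : T.IsTree) (R : H.RotationSystem) (hR : R.IsPlane) (d₀ : H.Dart)
    (hd₀ : ∀ d, R.facePerm.SameCycle d₀ d ↔ ∃ i, d.fst = x i ∧ d.snd = x (i + 1)) :
    (∀ i, ¬ R.facePerm.SameCycle d₀ (h.backDart i)) ∧
      ∀ i j, R.facePerm.SameCycle (h.backDart i) (h.backDart j) → x i = x j := by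
  classical
  have hn := h.three_le
  have : Finite H.Dart := Finite.of_injective Dart.toProd Dart.toProd_injective
  let q : H.Dart → R.Face := Quotient.mk (Equiv.Perm.SameCycle.setoid R.facePerm)
  have hq : ∀ d e, q d = q e ↔ R.facePerm.SameCycle d e := fun d e => Quotient.eq
  have hqs : Function.Surjective q := Quotient.mk_surjective
  have : Finite R.Face := Finite.of_surjective q hqs
  -- Every face contains a dart of the cycle, so the given face and those of the back darts exhaust
  -- all faces. Euler's formula gives at least as many faces as labels, hence no two labels share a
  -- face.
  let F : Option (Fin n) → R.Face := fun o => o.elim (q d₀) fun i => q (h.backDart i)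
  have hF : Function.Surjective F := by
    intro f
    obtain ⟨d, rfl⟩ := hqs f
    obtain ⟨e, he, hne⟩ := h.exists_not_adj hr P R d
    rw [(hq d e).2 he]
    rcases h.dart_cases e with h' | h' | ⟨i, rfl⟩
    · exact absurd h' hne
    · exact ⟨none, (hq _ _).2 ((hd₀ e).2 h')⟩
    · refine ⟨some ⟨i % n, Nat.mod_lt _ (by omega)⟩, ?_⟩
      change q (h.backDart (i % n)) = _
      rw [h.backDart_congr (h.apply_mod i)]
  have hcard : Nat.card (Option (Fin n)) ≤ Nat.card R.Face := by
    have h1 := hR.2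
    have h2 := h.card_edgeSet hr P hT
    rw [Nat.card_eq_fintype_card (α := V)] at h1
    rw [Nat.card_eq_fintype_card, Fintype.card_option, Fintype.card_fin]
    omega
  have hinj := (hF.bijective_of_nat_card_le hcard).injective
  have hFi : ∀ i, F (some ⟨i % n, Nat.mod_lt _ (by omega)⟩) = q (h.backDart i) := fun i => by
    change q (h.backDart (i % n)) = _
    rw [h.backDart_congr (h.apply_mod i)]
  constructor
  · intro i hi
    have : F none = F (some _) := ((hq _ _).2 hi).trans (hFi i).symm
    simpa using hinj this
  · intro i j hij
    have := hinj ((hFi i).trans (((hq _ _).2 hij).trans (hFi j).symm))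
    simp only [Option.some.injEq, Fin.mk.injEq] at this
    exact (h.eq_iff _ _).2 this

/-- At most two edges of the cycle leave the subtree below a vertex. -/
theorem exists_leaving_pairs (h : IsLeafCycle H T n x) {r : V} (hr : T.degree r ≠ 1)
    (P : Rooting T r) (hT : T.IsTree) (R : H.RotationSystem) (hR : R.IsPlane) (d₀ : H.Dart)
    (hd₀ : ∀ d, R.facePerm.SameCycle d₀ d ↔ ∃ i, d.fst = x i ∧ d.snd = x (i + 1)) (u : V) :
    ∃ E : Finset (V × V), #E ≤ 2 ∧ ∀ a b, P.Desc u a → ¬ P.Desc u b →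
      (∃ i, s(a, b) = s(x i, x (i + 1))) → (a, b) ∈ E := by
  classical
  obtain ⟨hout, hinj⟩ := h.backDart_face hr P hT R hR d₀ hd₀
  -- The back dart enters `S`, so its face must leave `S` again. It cannot do so on the cycle,
  -- because that face contains no forward dart and no other back dart.
  have key : ∀ (S : V → Prop) (i : ℕ), S (x i) → ¬ S (x (i + 1)) →
      ∃ e, R.facePerm.SameCycle (h.backDart i) e ∧ T.Adj e.fst e.snd ∧ S e.fst ∧ ¬ S e.snd := by
    intro S i h1 h2
    obtain ⟨e, he, he1, he2⟩ := R.exists_leaving_dart (d := h.backDart i) S h1 h2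
    refine ⟨e, he, ?_, he1, he2⟩
    rcases h.dart_cases e with h' | h' | ⟨j, rfl⟩
    · exact h'
    · exact absurd (((hd₀ e).2 h').trans he.symm) (hout i)
    · rw [← h.backDart_congr (hinj i j he)] at he1
      exact absurd he1 h2
  let E₁ : Finset (V × V) := {q | ∃ i, q = (x i, x (i + 1)) ∧ P.Desc u (x i) ∧ ¬ P.Desc u (x (i + 1))}
  let E₂ : Finset (V × V) := {q | ∃ i, q = (x (i + 1), x i) ∧ ¬ P.Desc u (x i) ∧ P.Desc u (x (i + 1))}
  have hE₁ : #E₁ ≤ 1 := by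
    refine card_le_one.2 fun a ha b hb => ?_
    obtain ⟨i, rfl, hi⟩ := (mem_filter.1 ha).2
    obtain ⟨j, rfl, hj⟩ := (mem_filter.1 hb).2
    -- The only tree dart leaving the subtree runs from `u` to its parent and lies in one face,
    -- which determines the cycle edge. For `E₂` the same argument uses the complement and the
    -- reverse dart.
    obtain ⟨e, he, heT, he1, he2⟩ := key (P.Desc u) i hi.1 hi.2
    obtain ⟨e', he', heT', he1', he2'⟩ := key (P.Desc u) j hj.1 hj.2
    have h1 := P.eq_of_adj_of_desc heT he1 he2
    have h2 := P.eq_of_adj_of_desc heT' he1' he2'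
    have : e = e' := Dart.ext _ _ (Prod.ext (h1.1.trans h2.1.symm) (h1.2.trans h2.2.symm))
    have hx := hinj i j (he.trans (this ▸ he'.symm))
    rw [hx, h.eq_succ hx]
  have hE₂ : #E₂ ≤ 1 := by
    refine card_le_one.2 fun a ha b hb => ?_
    obtain ⟨i, rfl, hi⟩ := (mem_filter.1 ha).2
    obtain ⟨j, rfl, hj⟩ := (mem_filter.1 hb).2
    obtain ⟨e, he, heT, he1, he2⟩ := key (fun v => ¬ P.Desc u v) i hi.1 (not_not.2 hi.2)
    obtain ⟨e', he', heT', he1', he2'⟩ := key (fun v => ¬ P.Desc u v) j hj.1 (not_not.2 hj.2)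
    have h1 := P.eq_of_adj_of_desc heT.symm (not_not.1 he2) he1
    have h2 := P.eq_of_adj_of_desc heT'.symm (not_not.1 he2') he1'
    have : e = e' := Dart.ext _ _ (Prod.ext (h1.2.trans h2.2.symm) (h1.1.trans h2.1.symm))
    have hx := hinj i j (he.trans (this ▸ he'.symm))
    rw [hx, h.eq_succ hx]
  refine ⟨E₁ ∪ E₂, (card_union_le _ _).trans (by omega), fun a b ha hb hab => ?_⟩
  obtain ⟨i, hi⟩ := hab
  rcases Sym2.eq_iff.1 hi with ⟨rfl, rfl⟩ | ⟨rfl, rfl⟩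
  · exact mem_union_left _ (mem_filter.2 ⟨mem_univ _, i, rfl, ha, hb⟩)
  · exact mem_union_right _ (mem_filter.2 ⟨mem_univ _, i, rfl, hb, ha⟩)

end IsLeafCycle

/-! ### Combining the tree and cycle colorings -/

/-- Star edge colorings in terms of the colors along trails with four edges. -/
theorem isStarEdgeColoring_of {H : SimpleGraph V} (c : Sym2 V → ℕ)
    (hproper : ∀ a b d, H.Adj a b → H.Adj b d → a ≠ d → c s(a, b) ≠ c s(b, d))
    (hstar : ∀ v₀ v₁ v₂ v₃ v₄, H.Adj v₀ v₁ → H.Adj v₁ v₂ → H.Adj v₂ v₃ → H.Adj v₃ v₄ → v₀ ≠ v₂ →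
      v₁ ≠ v₃ → v₂ ≠ v₄ → c s(v₀, v₁) = c s(v₂, v₃) → c s(v₁, v₂) ≠ c s(v₃, v₄)) :
    IsStarEdgeColoring (fun e : H.edgeSet => c e) := by
  -- The vertices `v₀` and `v₄` may coincide, so paths and four-cycles are treated together.
  have key : ∀ v₀ v₁ v₂ v₃ v₄, H.Adj v₀ v₁ → H.Adj v₁ v₂ → H.Adj v₂ v₃ → H.Adj v₃ v₄ → v₀ ≠ v₂ →
      v₁ ≠ v₃ → v₂ ≠ v₄ → ∀ S : Set ℕ, c s(v₀, v₁) ∈ S → c s(v₁, v₂) ∈ S → c s(v₂, v₃) ∈ S →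
      c s(v₃, v₄) ∈ S → S.ncard ≠ 2 := by
    intro v₀ v₁ v₂ v₃ v₄ a1 a2 a3 a4 h1 h2 h3 S m1 m2 m3 m4 hS
    obtain ⟨p, q, -, rfl⟩ := Set.ncard_eq_two.1 hS
    have p1 := hproper _ _ _ a1 a2 h1
    have p2 := hproper _ _ _ a2 a3 h2
    have p3 := hproper _ _ _ a3 a4 h3
    have p4 := hstar _ _ _ _ _ a1 a2 a3 a4 h1 h2 h3
    simp only [Set.mem_insert_iff, Set.mem_singleton_iff] at m1 m2 m3 m4
    grind
  have mem : ∀ {u v : V} (p : H.Walk u v) (a b : V) (h : H.Adj a b), s(a, b) ∈ p.edges →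
      c s(a, b) ∈ (fun e : H.edgeSet => c e) '' {e : H.edgeSet | (e : Sym2 V) ∈ p.edges} :=
    fun p a b h hp => ⟨⟨s(a, b), h⟩, hp, rfl⟩
  refine ⟨?_, ?_, ?_⟩
  · rintro ⟨e, he⟩ ⟨f, hf⟩ hadj
    obtain ⟨hne, b, hbe, hbf⟩ := lineGraph_adj_iff_exists.1 hadj
    obtain ⟨a, rfl⟩ := hbe
    obtain ⟨d, rfl⟩ := hbf
    dsimp only
    rw [Sym2.eq_swap]
    refine hproper _ _ _ ((mem_edgeSet H).1 he).symm hf ?_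
    rintro rfl
    exact hne rfl
  · intro u v p hp hl
    cases p with
    | nil => simp at hl
    | cons a1 p =>
    cases p with
    | nil => simp at hl
    | cons a2 p =>
    cases p with
    | nil => simp at hl
    | cons a3 p =>
    cases p with
    | nil => simp at hl
    | cons a4 p =>
    cases p with
    | cons a5 p => simp at hl
    | nil =>
      rw [Walk.isPath_def] at hp
      simp only [Walk.support_cons, Walk.support_nil, List.nodup_cons, List.mem_cons, not_or] at hp
      refine key _ _ _ _ _ a1 a2 a3 a4 ?_ ?_ ?_ _ (mem _ _ _ a1 ?_) (mem _ _ _ a2 ?_)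
        (mem _ _ _ a3 ?_) (mem _ _ _ a4 ?_)
      · tauto
      · tauto
      · tauto
      all_goals simp
  · intro u p hp hl
    cases p with
    | nil => simp at hl
    | cons a1 p =>
    cases p with
    | nil => simp at hl
    | cons a2 p =>
    cases p with
    | nil => simp at hl
    | cons a3 p =>
    cases p with
    | nil => simp at hl
    | cons a4 p =>
    cases p with
    | cons a5 p => simp at hl
    | nil =>
      have hp := hp.support_nodup
      simp only [Walk.support_cons, Walk.support_nil, List.tail_cons, List.nodup_cons,
        List.mem_cons, not_or] at hp
      refine key _ _ _ _ _ a1 a2 a3 a4 ?_ ?_ ?_ _ (mem _ _ _ a1 ?_) (mem _ _ _ a2 ?_)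
        (mem _ _ _ a3 ?_) (mem _ _ _ a4 ?_)
      · exact fun h => by rw [h] at hp; tauto
      · tauto
      · tauto
      all_goals simp

namespace IsLeafCycle

variable [Fintype V] {H T : SimpleGraph V} [DecidableRel T.Adj] {n : ℕ} {x : ℕ → V}

theorem exists_pred (h : IsLeafCycle H T n x) (i : ℕ) : ∃ k, x (k + 1) = x i :=
  ⟨i + (n - 1), by
    rw [add_assoc, Nat.sub_add_cancel (by have := h.three_le; omega), h.apply_add]⟩

/-- An edge at `x (i + 1)` is a tree edge or one of two edges of the cycle. -/
theorem adj_cases (h : IsLeafCycle H T n x) {i : ℕ} {v : V} (hv : H.Adj (x (i + 1)) v) :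
    T.Adj (x (i + 1)) v ∨ v = x i ∨ v = x (i + 2) := by
  rcases (h.adj_iff _ _).1 hv with h' | ⟨j, hj⟩
  · exact Or.inl h'
  · rcases Sym2.eq_iff.1 hj with ⟨h1, h2⟩ | ⟨h1, h2⟩
    · exact Or.inr (Or.inr (h2.trans (h.eq_succ h1).symm))
    · exact Or.inr (Or.inl (h2.trans (h.eq_of_eq_succ h1).symm))

/-- A tree coloring and a coloring of the cycle that avoids, at every edge, the critical colors at
its ends and the colors of the tree edges at the neighboring leaves, form a star edge coloring. -/
theorem isStarEdgeColoring (h : IsLeafCycle H T n x) {r : V} (hr : T.degree r ≠ 1)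
    (P : Rooting T r) (D : V → V → V → Prop) (hD : ∀ u v w, D u v w → ¬ D u w v) (f : V → ℕ)
    (hf : P.IsOriented D univ f) (hsucc : ∀ i, f (x i) ≠ f (x (i + 1))) (g : ℕ → ℕ)
    (hg : IsStarSequence g)
    (hg1 : ∀ i, g (i + 1) ≠ f (x i)) (hg2 : ∀ i, g i ≠ f (x (i + 2)))
    (hgl : ∀ i w, T.Adj (P.par (x i)) w → ¬ D (P.par (x i)) (x i) w →
      g i ≠ P.edgeColor f (P.par (x i)) w)
    (hgr : ∀ i w, T.Adj (P.par (x (i + 1))) w → ¬ D (P.par (x (i + 1))) (x (i + 1)) w →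
      g i ≠ P.edgeColor f (P.par (x (i + 1))) w)
    (c : Sym2 V → ℕ) (hcT : ∀ v, v ≠ r → c s(v, P.par v) = f v)
    (hcC : ∀ i, c s(x i, x (i + 1)) = g i) :
    IsStarEdgeColoring (fun e : H.edgeSet => c e) := by
  have hirr : ∀ u v, ¬ D u v v := fun u v hd => hD _ _ _ hd hd
  have hcT' : ∀ a b, T.Adj a b → c s(a, b) = P.edgeColor f a b := by
    intro a b hab
    rcases (P.adj_iff a b).1 hab with ⟨ha, rfl⟩ | ⟨hb, rfl⟩
    · rw [hcT a ha, P.edgeColor_par_right f ha]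
    · rw [Sym2.eq_swap, hcT b hb, P.edgeColor_par_left f hb]
  have hleaf : ∀ i v, T.Adj (x i) v → c s(x i, v) = f (x i) := by
    intro i v hv
    rw [h.eq_par hr P hv, hcT _ (h.ne_root hr i)]
  have hcC' : ∀ i, c s(x (i + 1), x i) = g i := fun i => by rw [Sym2.eq_swap, hcC]
  -- This extends the meaning of `D` from tree edges at `v` to cycle edges at a leaf `v`, which
  -- avoid the critical colors.
  have rel : ∀ u v w z, T.Adj u v → T.Adj u w → H.Adj v z → z ≠ u → c s(v, z) = c s(u, w) →
      D u v w := by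
    intro u v w z huv huw hvz hzu he
    rw [hcT' u w huw] at he
    rcases (h.adj_iff v z).1 hvz with hT | ⟨i, hi⟩
    · rw [hcT' v z hT] at he
      exact hf.rel hirr huv huw hT hzu he
    · rw [hi, hcC] at he
      by_contra hd
      rcases Sym2.eq_iff.1 hi with ⟨rfl, -⟩ | ⟨rfl, -⟩
      · obtain rfl := h.eq_par hr P huv.symm
        exact hgl i w huw hd he
      · obtain rfl := h.eq_par hr P huv.symm
        exact hgr i w huw hd he
  -- For a walk that passes from a tree edge to a cycle edge, the tree color at a leaf differs from
  -- the tree color at the next leaf and from the color of the cycle edge beyond it.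
  have turn : ∀ v₁ v₂ v₃ v₄ i, T.Adj v₁ v₂ → s(v₂, v₃) = s(x i, x (i + 1)) → H.Adj v₃ v₄ → v₂ ≠ v₄ →
      c s(v₁, v₂) ≠ c s(v₃, v₄) := by
    intro v₁ v₂ v₃ v₄ i h12 h23 h34 hne
    rw [Sym2.eq_swap]
    rcases Sym2.eq_iff.1 h23 with ⟨rfl, rfl⟩ | ⟨rfl, rfl⟩
    · rw [hleaf i v₁ h12.symm]
      rcases h.adj_cases h34 with h' | h' | h'
      · rw [hleaf _ _ h']
        exact hsucc i
      · exact absurd h'.symm hne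
      · rw [h', hcC]
        exact (hg1 i).symm
    · rw [hleaf _ v₁ h12.symm]
      obtain ⟨k, hk⟩ := h.exists_pred i
      have hk' : x (k + 2) = x (i + 1) := h.eq_succ hk
      rw [← hk] at h34 ⊢
      rw [← hk'] at hne ⊢
      rcases h.adj_cases h34 with h' | h' | h'
      · rw [hleaf _ _ h']
        exact (hsucc (k + 1)).symm
      · rw [h', hcC']
        exact (hg2 k).symm
      · exact absurd h'.symm hne
  -- Here the two middle edges are on the cycle. An outer tree edge is excluded by `hg1` or `hg2`;
  -- otherwise all four edges are consecutive on the cycle and `hg` applies.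
  have straight : ∀ v₀ v₄ i, H.Adj v₀ (x i) → H.Adj (x (i + 2)) v₄ → v₀ ≠ x (i + 1) →
      x (i + 1) ≠ v₄ → c s(v₀, x i) = g (i + 1) → g i ≠ c s(x (i + 2), v₄) := by
    intro v₀ v₄ i h0 h4 hne0 hne4 he he'
    obtain ⟨k, hk⟩ := h.exists_pred i
    have hk1 : x (k + 2) = x (i + 1) := h.eq_succ hk
    have hk2 : x (k + 3) = x (i + 2) := h.eq_succ hk1
    rcases h.adj_cases h4 with h' | h' | h'
    · rw [hleaf _ _ h'] at he'
      exact hg2 i he'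
    · exact hne4 h'.symm
    rw [← hk] at h0
    rw [Sym2.eq_swap] at he
    rcases h.adj_cases h0.symm with h'' | h'' | h''
    · rw [← hk, hleaf _ _ h'', hk] at he
      exact hg1 i he.symm
    · rw [h'', ← hk, hcC'] at he
      rw [h', hcC] at he'
      have e1 : g (k + 1) = g i := by rw [← hcC, ← hcC, ← hk, hk1]
      have e2 : g (k + 2) = g (i + 1) := by rw [← hcC, ← hcC, hk1, hk2]
      have e3 : g (k + 3) = g (i + 2) := by
        rw [← hcC, ← hcC, hk2, show x (k + 3 + 1) = x (i + 2 + 1) from h.eq_succ hk2]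
      exact hg.2 k (he.trans e2.symm) (by rw [e1, e3, he'])
    · exact hne0 (h''.trans hk1)
  refine isStarEdgeColoring_of c ?_ ?_
  · intro a b d hab hbd hne he
    -- With a tree edge present, properness is the case `w = v` of `rel`, excluded by irreflexivity.
    by_cases h1 : T.Adj a b
    · exact hirr _ _ (rel a b b d h1 h1 hbd hne.symm he.symm)
    by_cases h2 : T.Adj b d
    · exact hirr _ _ (rel d b b a h2.symm h2.symm hab.symm hne
        (by rwa [Sym2.eq_swap, Sym2.eq_swap (a := d)]))
    obtain ⟨i, hi⟩ := ((h.adj_iff _ _).1 hab).resolve_left h1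
    rcases Sym2.eq_iff.1 hi with ⟨rfl, rfl⟩ | ⟨rfl, rfl⟩
    · rcases h.adj_cases hbd with h' | h' | rfl
      · exact h2 h'
      · exact hne h'.symm
      · rw [hcC, hcC] at he
        exact hg.1 i he
    · obtain ⟨k, hk⟩ := h.exists_pred i
      have hk' : x (k + 2) = x (i + 1) := h.eq_succ hk
      rw [← hk] at hbd h2 he
      rw [← hk'] at hne he
      rcases h.adj_cases hbd with h' | rfl | h'
      · exact h2 h'
      · rw [hcC' (k + 1), hcC'] at he
        exact hg.1 k he.symm
      · exact hne h'.symm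
  · intro v₀ v₁ v₂ v₃ v₄ a1 a2 a3 a4 n02 n13 n24 e1 e2
    by_cases h1 : T.Adj v₁ v₂
    · by_cases h2 : T.Adj v₂ v₃
      · refine hD _ _ _ (rel v₂ v₁ v₃ v₀ h1.symm h2 a1.symm n02 ?_)
          (rel v₂ v₃ v₁ v₄ h2 h1.symm a4 n24.symm ?_)
        · rwa [Sym2.eq_swap]
        · rw [← e2, Sym2.eq_swap]
      · obtain ⟨i, hi⟩ := ((h.adj_iff _ _).1 a3).resolve_left h2
        exact turn _ _ _ _ i h1 hi a4 n24 e2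
    · obtain ⟨i, hi⟩ := ((h.adj_iff _ _).1 a2).resolve_left h1
      by_cases h2 : T.Adj v₂ v₃
      · refine turn v₃ v₂ v₁ v₀ i h2.symm (by rwa [Sym2.eq_swap]) a1.symm n02.symm ?_
        rw [Sym2.eq_swap, ← e1, Sym2.eq_swap]
      · rcases Sym2.eq_iff.1 hi with ⟨rfl, rfl⟩ | ⟨rfl, rfl⟩
        · rcases h.adj_cases a3 with h' | h' | rfl
          · exact h2 h'
          · exact n13 h'.symm
          · rw [hcC] at e1 e2
            exact straight v₀ v₄ i a1 a4 n02 n24 e1 e2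
        · obtain ⟨k, hk⟩ := h.exists_pred i
          have hk' : x (k + 2) = x (i + 1) := h.eq_succ hk
          rw [← hk] at a3 h2 e1 e2 n02 n24
          rw [← hk'] at a1 n13 e1 e2
          rcases h.adj_cases a3 with h' | rfl | h'
          · exact h2 h'
          · rw [hcC'] at e1
            rw [hcC' (k + 1)] at e2
            refine straight v₄ v₀ k a4.symm a1.symm n24.symm n02.symm ?_ ?_
            · rw [Sym2.eq_swap, e2]
            · rw [← e1, Sym2.eq_swap]
          · exact n13 h'.symm

/-- The two colorings combine to one coloring of all edges. -/
theorem exists_color (h : IsLeafCycle H T n x) {r : V} (hr : T.degree r ≠ 1)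
    (P : Rooting T r) (f : V → ℕ) (g : ℕ → ℕ) (hgp : ∀ i, g (i % n) = g i) :
    ∃ c : Sym2 V → ℕ, (∀ v, v ≠ r → c s(v, P.par v) = f v) ∧
      ∀ i, c s(x i, x (i + 1)) = g i := by
  classical
  refine ⟨fun e => if he : ∃ i, e = s(x i, x (i + 1)) then g he.choose
    else if he : ∃ v, v ≠ r ∧ e = s(v, P.par v) then f he.choose else 0, fun v hv => ?_, fun i => ?_⟩
  · have h1 : ¬ ∃ i, s(v, P.par v) = s(x i, x (i + 1)) := by
      rintro ⟨i, hi⟩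
      rcases Sym2.eq_iff.1 hi with ⟨-, h2⟩ | ⟨-, h2⟩
      · exact h.par_ne hr P hv _ h2
      · exact h.par_ne hr P hv _ h2
    have h2 : ∃ w, w ≠ r ∧ s(v, P.par v) = s(w, P.par w) := ⟨v, hv, rfl⟩
    dsimp only
    rw [dif_neg h1, dif_pos h2]
    obtain ⟨h3, h4⟩ := h2.choose_spec
    rcases Sym2.eq_iff.1 h4 with h5 | h5
    · rw [← h5.1]
    · refine absurd ?_ (P.par_par_ne hv (h5.2 ▸ h3))
      rw [h5.2]
      exact h5.1.symm
  · have h1 : ∃ j, s(x i, x (i + 1)) = s(x j, x (j + 1)) := ⟨i, rfl⟩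
    dsimp only
    rw [dif_pos h1]
    have := (h.eq_iff _ _).1 (h.eq_of_edge_eq h1.choose_spec)
    rw [← hgp i, ← hgp h1.choose, this]

/-- Planarity enters only through `hE`. Color the tree first; the 7 in `hK2` then leaves three
usable colors for every cycle edge. -/
theorem starEdgeChoosable (h : IsLeafCycle H T n x) (hn5 : n ≠ 5) {r : V} (hr : T.degree r ≠ 1)
    (P : Rooting T r)
    (hE : ∀ u, ∃ E : Finset (V × V), #E ≤ 2 ∧ ∀ a b, P.Desc u a → ¬ P.Desc u b →
      (∃ i, s(a, b) = s(x i, x (i + 1))) → (a, b) ∈ E)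
    (K : ℕ) (hK1 : ∀ u v, T.Adj u v → T.degree u + T.degree v / 2 ≤ K)
    (hK2 : ∀ u v, T.degree u / 2 + T.degree v / 2 + 7 ≤ K) : H.StarEdgeChoosable K := by
  classical
  intro L₀ hL₀
  let L : Sym2 V → Finset ℕ := fun e => if he : e ∈ H.edgeSet then L₀ ⟨e, he⟩ else range K
  have hL : ∀ e, K ≤ #(L e) := by
    intro e
    by_cases he : e ∈ H.edgeSet
    · simp only [L, dif_pos he]
      exact hL₀ _
    · simp only [L, dif_neg he, card_range]
      exact le_rfl
  choose D hDa hDc using fun u => exists_balanced_orientation (T.neighborFinset u)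
  simp only [card_neighborFinset_eq_degree] at hDc
  obtain ⟨f, hfL, hf, hfA⟩ := P.exists_isOriented D (fun u v hd => hDa u v v hd hd) hDc K
    (fun v => L s(v, P.par v)) (fun v => hL _) hK1
    (fun u v => (Nat.add_le_add_left (by norm_num) _).trans (hK2 u v))
    (fun a b => ∃ i, s(a, b) = s(x i, x (i + 1)))
    (fun a b ⟨i, hi⟩ => ⟨i, by rw [Sym2.eq_swap, hi]⟩)
    (by
      rintro a ⟨i, hi⟩
      have h1 := h.adj_succ i
      rcases Sym2.eq_iff.1 hi with h2 | h2 <;> rw [← h2.1, ← h2.2] at h1 <;> exact h1.ne rfl)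
    (by
      rintro a b z ⟨i, hi⟩ hz
      rcases Sym2.eq_iff.1 hi with h2 | h2 <;> rw [h2.2] <;> exact h.par_ne hr P hz _)
    (fun u => by
      obtain ⟨E, h1, h2⟩ := hE u
      exact ⟨E, h1, fun a b ha hab hb => h2 a b ⟨1, ha⟩ hb hab⟩)
  let F : V → Finset ℕ := fun v =>
    {w ∈ T.neighborFinset (P.par v) | ¬ D (P.par v) v w}.image (P.edgeColor f (P.par v))
  have hF : ∀ i, #(F (x i)) ≤ 1 + T.degree (P.par (x i)) / 2 := fun i =>
    card_image_le.trans (hDc _ _ (by simpa using (P.adj_par (h.ne_root hr i)).symm) _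
      (filter_subset _ _) fun w hw => (mem_filter.1 hw).2)
  -- The allowed colors depend on vertices rather than indices, so that membership passes from `i %
  -- n` to `i`.
  let Φ : V → V → V → V → Finset ℕ := fun a b c d => L s(b, c) \ (F b ∪ F c ∪ {f a, f d})
  have hA : ∀ i, ∃ A ⊆ Φ (x (i + (n - 1))) (x i) (x (i + 1)) (x (i + 2)), #A = 3 := by
    intro i
    -- The losses are `1 + d/2` for each end and two neighboring tree colors, 4 beyond the two
    -- halves, which leaves three. The index `i + (n - 1)` is the predecessor of `i`.
    refine exists_subset_card_eq ?_
    have h1 := le_card_sdiff (F (x i) ∪ F (x (i + 1)) ∪ {f (x (i + (n - 1))), f (x (i + 2))})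
      (L s(x i, x (i + 1)))
    have h2 := card_union_le (F (x i) ∪ F (x (i + 1))) {f (x (i + (n - 1))), f (x (i + 2))}
    have h3 := card_union_le (F (x i)) (F (x (i + 1)))
    have h4 := hF i
    have h5 := hF (i + 1)
    have h6 := card_le_two (a := f (x (i + (n - 1)))) (b := f (x (i + 2)))
    have h7 := hL s(x i, x (i + 1))
    have h8 := hK2 (P.par (x i)) (P.par (x (i + 1)))
    change 3 ≤ #(_ \ _)
    omega
  choose A hAsub hA3 using hA
  obtain ⟨g, hgp, hgA, hgs⟩ := exists_isStarSequence h.three_le hn5 (fun i => A (i % n))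
    (fun i => by simp) (fun i => hA3 _)
  have hmod : ∀ i k, x (i % n + k) = x (i + k) := fun i k =>
    (h.eq_iff _ _).2 ((Nat.mod_modEq i n).add_right k)
  have hgΦ : ∀ i, g i ∈ Φ (x (i + (n - 1))) (x i) (x (i + 1)) (x (i + 2)) := by
    intro i
    have := hAsub _ (hgA i)
    rwa [hmod, hmod, hmod, h.apply_mod] at this
  simp only [Φ, mem_sdiff, mem_union, mem_insert, mem_singleton, not_or] at hgΦ
  have hFmem : ∀ v w, T.Adj (P.par v) w → ¬ D (P.par v) v w →
      P.edgeColor f (P.par v) w ∈ F v := fun v w hw hd =>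
    mem_image_of_mem _ (mem_filter.2 ⟨by simpa using hw, hd⟩)
  have hgmod : ∀ i, g (i % n) = g i := by
    have hmul : ∀ i m, g (i + m * n) = g i := by
      intro i m
      induction m with
      | zero => simp
      | succ m ih => rw [Nat.succ_mul, ← add_assoc, hgp, ih]
    intro i
    have := hmul (i % n) (i / n)
    rwa [Nat.mod_add_div', eq_comm] at this
  obtain ⟨c, hcT, hcC⟩ := h.exists_color hr P f g hgmod
  refine ⟨fun e => c e, h.isStarEdgeColoring hr P D hDa f hf ?_ g hgs ?_ ?_ ?_ ?_ c hcT hcC, ?_⟩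
  · exact fun i => hfA _ _ (h.ne_root hr _) (h.ne_root hr _) ⟨i, rfl⟩
  · intro i he
    refine (hgΦ (i + 1)).2.2.1 ?_
    rw [he, show i + 1 + (n - 1) = i + n by have := h.three_le; omega, h.apply_add]
  · exact fun i => (hgΦ i).2.2.2
  · exact fun i w hw hd he => (hgΦ i).2.1.1 (he ▸ hFmem _ w hw hd)
  · exact fun i w hw hd he => (hgΦ i).2.1.2 (he ▸ hFmem _ w hw hd)
  · rintro ⟨e, he⟩
    have hLe : L e = L₀ ⟨e, he⟩ := dif_pos he
    rw [← hLe]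
    dsimp only
    induction e using Sym2.ind with
    | _ a b =>
      rcases (h.adj_iff a b).1 he with hT | ⟨i, hi⟩
      · rcases (P.adj_iff a b).1 hT with ⟨ha, rfl⟩ | ⟨hb, rfl⟩
        · rw [hcT a ha]
          exact hfL a
        · rw [Sym2.eq_swap, hcT b hb]
          exact hfL b
      · rw [hi, hcC]
        exact (hgΦ i).1

end IsLeafCycle

/-! ### The bound in terms of `θ` and `Δ` -/

theorem degree_add_degree_le_maxOreDegree [Fintype V] (T : SimpleGraph V) [DecidableRel T.Adj]
    {u v : V} (h : T.Adj u v) : T.degree u + T.degree v ≤ T.maxOreDegree :=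
  Finset.le_sup (f := fun d : T.Dart => T.degree d.fst + T.degree d.snd)
    (mem_univ (⟨(u, v), h⟩ : T.Dart))

theorem IsGeneralizedHalin.starEdgeChoosable [Fintype V] {H T : SimpleGraph V}
    [DecidableRel T.Adj] {u : V} {C : H.Walk u u} (hH : IsGeneralizedHalin H T C)
    (hC : C.length ≠ 5) (R : H.RotationSystem) (hR : R.IsPlane) (hRC : R.IsFaceBoundary C) :
    H.StarEdgeChoosable (max ((T.maxOreDegree + T.maxDegree) / 2) (2 * (T.maxDegree / 2) + 7)) := by
  obtain ⟨h, hdarts⟩ := hH.isLeafCycle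
  have : Nonempty V := ⟨u⟩
  obtain ⟨r, hr⟩ := T.exists_maximal_degree_vertex
  have hΔ := hH.three_le_maxDegree
  have hr1 : T.degree r ≠ 1 := by omega
  obtain ⟨P⟩ := hH.isTree.nonempty_rooting r
  obtain ⟨d₀, hd₀⟩ := hRC
  refine h.starEdgeChoosable hC hr1 P (fun v => h.exists_leaving_pairs hr1 P hH.isTree R hR d₀
    (fun d => (hd₀ d).trans (hdarts d)) v) _ (fun v w hvw => ?_) fun v w => ?_
  · have h1 := T.degree_add_degree_le_maxOreDegree hvw
    have h2 := T.degree_le_maxDegree v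
    -- Adding `d(v) + d(w) ≤ θ` and `d(v) ≤ Δ` gives `2 d(v) + d(w) ≤ θ + Δ`; now halve.
    refine le_max_of_le_left ?_
    omega
  · have h1 := T.degree_le_maxDegree v
    have h2 := T.degree_le_maxDegree w
    refine le_max_of_le_right ?_
    omega

end SimpleGraph

theorem theorem1p7 {V : Type*} [Fintype V] (H T : SimpleGraph V) [DecidableRel T.Adj]
    {u : V} (C : H.Walk u u) (hH : SimpleGraph.IsGeneralizedHalin H T C) (hC : C.length ≠ 5) :
    H.listStarChromaticIndex ≤
      ((max ((T.maxOreDegree + T.maxDegree) / 2) (2 * (T.maxDegree / 2) + 7) : ℕ) : ℕ∞) := by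
  refine iInf₂_le _ ?_
  obtain ⟨R, hR, hRC | hRC⟩ := hH.plane
  · exact hH.starEdgeChoosable hC R hR hRC
  · exact hH.reverse.starEdgeChoosable (by rwa [SimpleGraph.Walk.length_reverse]) R hR hRC
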